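/- Let $\Sigma=S^1\times[0,1]$ and let $G\subseteq\Sigma$ be a graph inducing a finite regular cellular decomposition of $\Sigma$ into vertices $V$, edges $E$ and faces $F$; that is, $G$ is the 1-skeleton of a finite CW structure on $\Sigma$ with cells of dimension at most $2$ whose characteristic maps are injective on the closed balls (every closed edge is an arc and every closed face is a closed disc, bounded by a cycle of $G$). The length of such a cycle, or of a boundary circle of $\Sigma$, is its number of edges. Assume: (G1) $|V|$ is even; (G2) every vertex has degree $3$; (G3) the boundary of every face has even length; (G4) each of the boundary circles $S^1\times\{0\}$ and $S^1\times\{1\}$ has odd length. Call a face adjacent to a vertex if the vertex lies on the boundary of the face. Then there is a partition of $F$ into two disjoint (possibly empty) subsets $F_0$ and $F_1$ such that every vertex has exactly two adjacent faces in $F_1$ and every vertex not lying on $\partial\Sigma=S^1\times\{0,1\}$ has exactly one adjacent face in $F_0$. Moreover, $(F_0,F_1)$ is the only partition of $F$ into two disjoint subsets for which every vertex has exactly two adjacent faces in $F_1$. -/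

import Mathlib

open Topology

/-- The cylinder `Σ = S¹ × [0,1]`. -/
abbrev Cylinder : Type := Circle × unitInterval

namespace Cylinder

/-- The boundary component `S¹ × {t}` for `t = 0, 1` (in general the horizontal circle at `t`). -/
def circleAt (t : unitInterval) : Set Cylinder := {p | p.2 = t}

/-- The boundary `∂Σ` of the cylinder. -/
def rim : Set Cylinder := circleAt 0 ∪ circleAt 1

/-- A CW structure on the cylinder is a regular cellular decomposition (induced by its graph of
`0`-cells and `1`-cells) if it has finitely many cells, all of dimension at most two, and if every
closed cell is embedded: each closed edge is an arc, each closed face is a closed disc. -/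
structure IsCellularDecomposition [CWComplex (Set.univ : Set Cylinder)] : Prop where
  finite : RelCWComplex.Finite (Set.univ : Set Cylinder)
  dim_le_two : ∀ n : ℕ, 2 < n → IsEmpty (RelCWComplex.cell (Set.univ : Set Cylinder) n)
  regular : ∀ (n : ℕ) (i : RelCWComplex.cell (Set.univ : Set Cylinder) n),
    Set.InjOn (RelCWComplex.map (C := Set.univ) n i) (Metric.closedBall 0 1)

section

variable [CWComplex (Set.univ : Set Cylinder)]

/-- The set `V` of vertices. -/
abbrev Vertex : Type := RelCWComplex.cell (Set.univ : Set Cylinder) 0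

/-- The set `E` of edges. -/
abbrev Edge : Type := RelCWComplex.cell (Set.univ : Set Cylinder) 1

/-- The set `F` of faces. -/
abbrev Face : Type := RelCWComplex.cell (Set.univ : Set Cylinder) 2

/-- The point of the cylinder at which a vertex sits. -/
noncomputable def Vertex.pos (v : Vertex) : Cylinder := RelCWComplex.map (C := Set.univ) 0 v 0

/-- The boundary of a face, as a set of points of the cylinder. -/
noncomputable def Face.boundary (f : Face) : Set Cylinder := RelCWComplex.cellFrontier (C := Set.univ) 2 f

/-- The degree of a vertex: the number of edges having it as an endpoint (regularity excludes
loops; parallel edges are counted separately). -/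
noncomputable def Vertex.degree (v : Vertex) : ℕ :=
  {e : Edge | Vertex.pos v ∈ RelCWComplex.cellFrontier (C := Set.univ) 1 e}.ncard

/-- The length of a cycle of the graph, given as a set of points: its number of edges. -/
noncomputable def length (S : Set Cylinder) : ℕ :=
  {e : Edge | RelCWComplex.closedCell (C := Set.univ) 1 e ⊆ S}.ncard

/-- The face `f` is adjacent to the vertex `u`, that is, `u` lies on the boundary of `f`. -/
def Face.AdjacentTo (f : Face) (u : Vertex) : Prop := Vertex.pos u ∈ Face.boundary f

end

end Cylinder

/-! Call the faces, together with the outside `none` of the cylinder, the sides. Every edge lies on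
exactly two sides, and since vertices are cubic, every vertex has three edges and three sides, each
side missing exactly one of the edges (`Vertex.exists_local`). Along an edge from `u` to `v` there
is thus a natural bijection between the sides at `u` and those at `v`: the two sides of the edge are
kept, and the third goes to the third. A choice of one side per vertex that respects these
bijections is called flat.

Transport around a face `f` fixes `f`, and every step of the walk interchanges the roles of the
other two sides: the one on the edge just traversed and the one on the edge ahead. Since the length
is even, the holonomy is trivial (`exists_isFlatOn_boundary`). So the sides form a three-sheeted
covering of the whole cylinder, not only of the graph. Its holonomy is governed by one boundary
circle, along which the outside is a flat choice. That section over the circle extends to the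
cylinder (`exists_section_of_isCoveringMap`) and gives a global flat choice `m`
(`exists_isFlatOn_univ`).

On a boundary circle of odd length every flat choice is the outside: any other choice would lie on
exactly one of the two circle edges at each vertex and so match the vertices of the circle in pairs
(`IsFlatOn.eq_none`). Hence `m` is `none` on the rim and a face elsewhere. By flatness, a face
chosen at one of its vertices is chosen at all of them, so the set of chosen faces is the required
`F₀`.

Conversely, if every vertex has exactly two faces in `F₁`, the remaining side at each vertex is a
flat choice. It is `none` on the rim, and a flat choice is determined by its value at one vertex, so
it equals `m`.

The planar topology behind "exactly two sides" rests on invariance of domain, proved here with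
continuous logarithms. -/

/-! ### Continuous logarithms and invariance of domain in the plane. -/

/-- A continuous logarithm can be transported along a homotopy of maps into `ℂ \ {0}`. -/
theorem exists_log_of_homotopy {A : Type*} [TopologicalSpace A] (H : unitInterval × A → ℂ)
    (hH : Continuous H) (hne : ∀ p, H p ≠ 0)
    (h0 : ∃ l : A → ℂ, Continuous l ∧ ∀ a, Complex.exp (l a) = H (0, a)) :
    ∃ l : A → ℂ, Continuous l ∧ ∀ a, Complex.exp (l a) = H (1, a) := by
  obtain ⟨l, hl, hlH⟩ := h0
  let K : C(unitInterval × A, {z : ℂ // z ≠ 0}) :=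
    ⟨fun p => ⟨H p, hne p⟩, hH.subtype_mk _⟩
  have hK : ∀ a, K (0, a) = ⟨Complex.exp (l a), Complex.exp_ne_zero _⟩ :=
    fun a => Subtype.ext (hlH a).symm
  let Lf := Complex.isCoveringMap_exp.liftHomotopy K ⟨l, hl⟩ hK
  refine ⟨fun a => Lf (1, a), Lf.continuous.comp (by fun_prop), fun a => ?_⟩
  have := congrFun (Complex.isCoveringMap_exp.liftHomotopy_lifts K ⟨l, hl⟩ hK) (1, a)
  exact congrArg Subtype.val this

/-- An odd nowhere vanishing function on the circle has no continuous logarithm. -/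
theorem not_exists_log_of_odd (g : Circle → ℂ) (hodd : ∀ z : Circle, g (-z) = -g z) :
    ¬ ∃ l : Circle → ℂ, Continuous l ∧ ∀ z, Complex.exp (l z) = g z := by
  rintro ⟨l, hl, hg⟩
  -- The difference `l (-z) - l z` is an odd multiple of `πi`, constant because the circle is
  -- connected. Replacing `z` by `-z` negates it, but no odd number is its own negative.
  have key : ∀ z : Circle, ∃ n : ℤ, l (-z) - l z = (2 * n + 1) * (Real.pi * Complex.I) := by
    intro z
    have h1 : Complex.exp (l (-z)) = Complex.exp (l z + Real.pi * Complex.I) := by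
      rw [Complex.exp_add, Complex.exp_pi_mul_I, hg, hg, hodd]; ring
    obtain ⟨n, hn⟩ := Complex.exp_eq_exp_iff_exists_int.1 h1
    exact ⟨n, by rw [hn]; ring⟩
  choose n hn using key
  have hpi : (Real.pi : ℂ) * Complex.I ≠ 0 := by simp [Real.pi_ne_zero]
  have hn' : ∀ z, (n z : ℝ) = (((l (-z) - l z) / (Real.pi * Complex.I) - 1) / 2).re := by
    intro z
    rw [hn, mul_div_cancel_right₀ _ hpi]
    simp
  have hcont : Continuous fun z => (n z : ℝ) := by
    simp_rw [hn']
    exact Complex.continuous_re.comp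
      ((((hl.comp continuous_neg).sub hl).div_const _ |>.sub continuous_const).div_const _)
  have hcn : Continuous n := Int.isClosedEmbedding_coe_real.isEmbedding.continuous_iff.2 hcont
  have hconst : n (-1) = n 1 := PreconnectedSpace.constant inferInstance hcn
  have h1 := hn 1
  have h2 := hn (-1)
  rw [neg_neg, hconst] at h2
  have h3 : ((2 * n 1 + 1 + (2 * n 1 + 1) : ℤ) : ℂ) * (Real.pi * Complex.I) = 0 := by
    push_cast
    linear_combination -h1 - h2
  rcases mul_eq_zero.1 h3 with h | h
  · have := Int.cast_eq_zero.1 h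
    omega
  · exact hpi h

/-- The image of a closed disc under an injective continuous map to the plane is a neighbourhood
of the image of the centre. -/
theorem image_closedBall_mem_nhds {f : ℂ → ℂ} (hf : ContinuousOn f (Metric.closedBall 0 1))
    (hinj : Set.InjOn f (Metric.closedBall 0 1)) : f '' Metric.closedBall 0 1 ∈ 𝓝 (f 0) := by
  have hmem : ∀ (r : ℝ) (z : Circle), |r| ≤ 1 → (r : ℂ) * z ∈ Metric.closedBall (0 : ℂ) 1 := by
    intro r z hr
    rw [mem_closedBall_zero_iff, norm_mul, Complex.norm_real, Circle.norm_coe, mul_one]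
    exact hr
  have h0 : (0 : ℂ) ∈ Metric.closedBall (0 : ℂ) 1 := by simp
  have hfc : ∀ {A : Type} [TopologicalSpace A] (r : A → ℝ) (z : A → Circle), Continuous r →
      Continuous z → (∀ a, |r a| ≤ 1) → Continuous fun a => f ((r a : ℂ) * z a) := by
    intro A _ r z hr hz hr1
    exact hf.comp_continuous (by fun_prop) fun a => hmem _ _ (hr1 a)
  obtain ⟨z₀, hz₀⟩ := (hfc (fun _ => (1 : ℝ)) id continuous_const continuous_id
    (by simp)).sub continuous_const |>.norm.exists_forall_le_of_hasCompactMulSupport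
      (f := fun z : Circle => ‖f (((1 : ℝ) : ℂ) * z) - f 0‖)
      (HasCompactMulSupport.of_compactSpace _)
  set ε := ‖f (((1 : ℝ) : ℂ) * z₀) - f 0‖ with hε
  have hεpos : 0 < ε := by
    rw [hε, norm_pos_iff, sub_ne_zero]
    intro h
    have := hinj (hmem 1 z₀ (by simp)) h0 h
    simp at this
  refine Filter.mem_of_superset (Metric.ball_mem_nhds _ hεpos) fun w hw => ?_
  by_contra hwn
  have hwf : ∀ x ∈ Metric.closedBall (0 : ℂ) 1, f x - w ≠ 0 := fun x hx h =>
    hwn ⟨x, hx, sub_eq_zero.1 h⟩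
  have hI : ∀ t : unitInterval, |(t : ℝ)| ≤ 1 := fun t => by
    rw [abs_of_nonneg t.2.1]; exact t.2.2
  -- If `w` is not in the image, shrinking the circle to the centre gives `f - w` a logarithm on the
  -- unit circle.
  have e1 := exists_log_of_homotopy (A := Circle)
    (fun p => f (((p.1 : ℝ) : ℂ) * p.2) - w)
    ((hfc (fun p : unitInterval × Circle => (p.1 : ℝ)) (fun p => p.2) (by fun_prop) (by fun_prop)
      fun p => hI p.1).sub continuous_const)
    (fun p => hwf _ (hmem _ _ (hI p.1)))
    ⟨fun _ => Complex.log (f 0 - w), continuous_const, fun a => by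
      rw [Complex.exp_log (hwf 0 h0)]; simp⟩
  -- Moving `w` straight to `f 0` does not meet the image of the circle, which stays at distance at
  -- least `ε` from `f 0`.
  have e2 := exists_log_of_homotopy (A := Circle)
    (fun p => f (((1 : ℝ) : ℂ) * p.2) - w - (p.1 : ℝ) * (f 0 - w))
    (((hfc (fun p : unitInterval × Circle => 1) (fun p => p.2) (by fun_prop) (by fun_prop)
      fun p => by simp).sub continuous_const).sub (by fun_prop))
    (fun p h => by
      have h1 : f (((1 : ℝ) : ℂ) * p.2) - f 0 = ((1 - p.1 : ℝ) : ℂ) * (w - f 0) := by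
        push_cast at h ⊢
        linear_combination h
      have h2 := hz₀ p.2
      have h3 : ‖((1 - p.1 : ℝ) : ℂ) * (w - f 0)‖ < ε := by
        rw [norm_mul, Complex.norm_real, Real.norm_eq_abs, abs_of_nonneg (by linarith [p.1.2.2])]
        rw [Metric.mem_ball, dist_eq_norm] at hw
        have := p.1.2.1
        nlinarith [norm_nonneg (w - f 0)]
      simp only [h1] at h2
      linarith)
    (by simpa using e1)
  -- The two arguments, both on the line through `p.2`, always differ by `p.2`, so injectivity keeps
  -- the difference nonzero. It deforms `f z - f 0` into the odd function `f (z/2) - f (-z/2)`.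
  have e3 := exists_log_of_homotopy (A := Circle)
    (fun p => f (((1 / (1 + p.1) : ℝ) : ℂ) * p.2) - f (((-(p.1 / (1 + p.1)) : ℝ) : ℂ) * p.2))
    ((hfc (fun p : unitInterval × Circle => 1 / (1 + p.1 : ℝ)) (fun p => p.2)
      (by
        refine continuous_const.div (by fun_prop) fun p => ?_
        linarith [p.1.2.1]) (by fun_prop)
      fun p => by
        have := p.1.2.1
        rw [abs_of_nonneg (by positivity), div_le_one (by linarith)]
        linarith).sub
     (hfc (fun p : unitInterval × Circle => -(p.1 / (1 + p.1 : ℝ))) (fun p => p.2)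
      (by
        refine (Continuous.div (by fun_prop) (by fun_prop) fun p => ?_).neg
        linarith [p.1.2.1]) (by fun_prop)
      fun p => by
        have := p.1.2.1
        rw [abs_neg, abs_of_nonneg (by positivity), div_le_one (by linarith)]
        linarith))
    (fun p h => by
      have := p.1.2.1
      have h1 := hinj (hmem _ _ (by
        rw [abs_of_nonneg (by positivity), div_le_one (by linarith)]
        linarith)) (hmem _ _ (by
        rw [abs_neg, abs_of_nonneg (by positivity), div_le_one (by linarith)]
        linarith)) (sub_eq_zero.1 h)
      have h2 := Complex.ofReal_injective (mul_right_cancel₀ (Circle.coe_ne_zero p.2) h1)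
      have h3 : 0 < 1 / (1 + (p.1 : ℝ)) := by positivity
      have h4 : 0 ≤ (p.1 : ℝ) / (1 + (p.1 : ℝ)) := by positivity
      linarith)
    (by simpa using e2)
  refine not_exists_log_of_odd _ (fun z => ?_) e3
  have : ∀ r : ℝ, (r : ℂ) * ((-z : Circle) : ℂ) = ((-r : ℝ) : ℂ) * z := by
    intro r; push_cast; simp
  simp only [this]
  norm_num

/-- **Invariance of domain** in the plane. -/
theorem image_mem_nhds_of_injOn {f : ℂ → ℂ} {U : Set ℂ} (hf : ContinuousOn f U)
    (hinj : Set.InjOn f U) {x : ℂ} (hU : U ∈ 𝓝 x) : f '' U ∈ 𝓝 (f x) := by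
  obtain ⟨r, hr, hrU⟩ := Metric.nhds_basis_closedBall.mem_iff.1 hU
  have hmaps : ∀ z ∈ Metric.closedBall (0 : ℂ) 1, x + r * z ∈ U := by
    intro z hz
    apply hrU
    simp only [Metric.mem_closedBall, dist_zero_right, dist_self_add_left, norm_mul,
      Complex.norm_real, Real.norm_eq_abs, abs_of_pos hr] at hz ⊢
    nlinarith
  have := image_closedBall_mem_nhds (f := fun z => f (x + r * z))
    (hf.comp (by fun_prop) hmaps) (fun a ha b hb h => by
      have := hinj (hmaps a ha) (hmaps b hb) h
      simpa [hr.ne'] using this)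
  simp only [mul_zero, add_zero] at this
  refine Filter.mem_of_superset this ?_
  rintro _ ⟨z, hz, rfl⟩
  exact ⟨_, hmaps z hz, rfl⟩

/-- The inverse of a continuous injection on a compact set is continuous on the image. -/
theorem IsCompact.continuousOn_invFunOn {A B : Type*} [TopologicalSpace A] [Nonempty A]
    [TopologicalSpace B] [T2Space B] {f : A → B} {K : Set A} (hK : IsCompact K)
    (hf : ContinuousOn f K) (hinj : Set.InjOn f K) :
    ContinuousOn (Function.invFunOn f K) (f '' K) := by
  rw [continuousOn_iff_isClosed]
  intro t ht
  refine ⟨f '' (K ∩ t), ((hK.inter_right ht).image_of_continuousOn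
    (hf.mono Set.inter_subset_left)).isClosed, ?_⟩
  ext y
  constructor
  · rintro ⟨hy, x, hx, rfl⟩
    refine ⟨⟨x, ⟨hx, ?_⟩, rfl⟩, x, hx, rfl⟩
    simpa [hinj.leftInvOn_invFunOn hx] using hy
  · rintro ⟨⟨x, ⟨hx, hxt⟩, rfl⟩, -⟩
    refine ⟨?_, x, hx, rfl⟩
    simpa [hinj.leftInvOn_invFunOn hx] using hxt

/-- The image of an interval under a continuous injection into the line is a neighbourhood of the
image of the midpoint. -/
theorem image_Icc_mem_nhds_of_injOn {h : ℝ → ℝ} {t ε : ℝ} (hε : 0 < ε)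
    (hc : ContinuousOn h (Set.Icc (t - ε) (t + ε))) (hi : Set.InjOn h (Set.Icc (t - ε) (t + ε))) :
    h '' Set.Icc (t - ε) (t + ε) ∈ 𝓝 (h t) := by
  have hle : t - ε ≤ t + ε := by linarith
  have ma : t - ε ∈ Set.Icc (t - ε) (t + ε) := ⟨le_rfl, hle⟩
  have mb : t + ε ∈ Set.Icc (t - ε) (t + ε) := ⟨hle, le_rfl⟩
  have mt : t ∈ Set.Icc (t - ε) (t + ε) := ⟨by linarith, by linarith⟩
  rcases hc.strictMonoOn_of_injOn_Icc' hle hi with hm | hm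
  · exact Filter.mem_of_superset
      (Icc_mem_nhds (hm ma mt (by linarith)) (hm mt mb (by linarith))) (intermediate_value_Icc hle hc)
  · exact Filter.mem_of_superset
      (Icc_mem_nhds (hm mt mb (by linarith)) (hm ma mt (by linarith))) (intermediate_value_Icc' hle hc)

/-! ### The cylinder as a plane annulus; detecting the rim. -/

namespace Cylinder

/-- The standard embedding of the cylinder in the plane as a closed annulus. -/
noncomputable def toPlane (x : Cylinder) : ℂ := ((1 + x.2 : ℝ) : ℂ) * x.1

theorem continuous_toPlane : Continuous toPlane := by
  unfold toPlane
  fun_prop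

theorem norm_toPlane (x : Cylinder) : ‖toPlane x‖ = 1 + x.2 := by
  rw [toPlane, norm_mul, Complex.norm_real, Circle.norm_coe, mul_one, Real.norm_eq_abs,
    abs_of_nonneg (by linarith [x.2.2.1])]

theorem injective_toPlane : Function.Injective toPlane := by
  intro x y h
  have h2 : x.2 = y.2 := by
    have := congrArg norm h
    rw [norm_toPlane, norm_toPlane] at this
    exact Subtype.ext (by linarith)
  refine Prod.ext ?_ h2
  rw [toPlane, toPlane, h2] at h
  have hne : ((1 + y.2 : ℝ) : ℂ) ≠ 0 := by
    rw [Complex.ofReal_ne_zero]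
    linarith [y.2.2.1]
  exact Circle.coe_injective (mul_left_cancel₀ hne h)

theorem range_toPlane : Set.range toPlane = {w : ℂ | 1 ≤ ‖w‖ ∧ ‖w‖ ≤ 2} := by
  ext w
  constructor
  · rintro ⟨x, rfl⟩
    rw [Set.mem_ofPred_eq, norm_toPlane]
    exact ⟨by linarith [x.2.2.1], by linarith [x.2.2.2]⟩
  · rintro ⟨h1, h2⟩
    refine ⟨(Circle.exp w.arg, ⟨‖w‖ - 1, by linarith, by linarith⟩), ?_⟩
    rw [toPlane, Circle.coe_exp, add_sub_cancel, Complex.norm_mul_exp_arg_mul_I]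

theorem isEmbedding_toPlane : IsEmbedding toPlane :=
  (continuous_toPlane.isClosedEmbedding injective_toPlane).isEmbedding

theorem mem_rim_iff (x : Cylinder) : x ∈ rim ↔ ‖toPlane x‖ = 1 ∨ ‖toPlane x‖ = 2 := by
  rw [norm_toPlane]
  have h0 : x.2 = 0 ↔ (x.2 : ℝ) = 0 := by rw [Subtype.ext_iff]; rfl
  have h1 : x.2 = 1 ↔ (x.2 : ℝ) = 1 := by rw [Subtype.ext_iff]; rfl
  simp only [rim, circleAt, Set.mem_union, Set.mem_ofPred_eq, h0, h1]
  constructor <;> rintro (h | h)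
  · left; linarith
  · right; linarith
  · left; linarith
  · right; linarith

theorem image_toPlane_mem_nhds {x : Cylinder} (hx : x ∉ rim) {N : Set Cylinder} (hN : N ∈ 𝓝 x) :
    toPlane '' N ∈ 𝓝 (toPlane x) := by
  rw [isEmbedding_toPlane.nhds_eq_comap, Filter.mem_comap] at hN
  obtain ⟨t, ht, htN⟩ := hN
  rw [mem_rim_iff, not_or] at hx
  have hr : toPlane x ∈ Set.range toPlane := ⟨x, rfl⟩
  rw [range_toPlane] at hr
  have h1 : 1 < ‖toPlane x‖ := lt_of_le_of_ne hr.1 (Ne.symm hx.1)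
  have h2 : ‖toPlane x‖ < 2 := lt_of_le_of_ne hr.2 hx.2
  filter_upwards [ht, continuous_norm.continuousAt.eventually (lt_mem_nhds h1),
    continuous_norm.continuousAt.eventually (gt_mem_nhds h2)] with w hw hw1 hw2
  have : w ∈ Set.range toPlane := by
    rw [range_toPlane]
    exact ⟨hw1.le, hw2.le⟩
  obtain ⟨y, rfl⟩ := this
  exact ⟨y, htN hw, rfl⟩

/-- From a point of the rim, an arbitrarily small motion along its ray leaves the annulus. -/
theorem notMem_rim_of_image_mem_nhds {x : Cylinder} {N : Set Cylinder}
    (hN : toPlane '' N ∈ 𝓝 (toPlane x)) : x ∉ rim := by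
  have hpos : 0 < ‖toPlane x‖ := by
    rw [norm_toPlane]
    linarith [x.2.2.1]
  have hc : Continuous fun r : ℝ => (r : ℂ) * toPlane x := by fun_prop
  have h := hc.continuousAt.preimage_mem_nhds (x := 1) (by simpa using hN)
  obtain ⟨ε, hε, hball⟩ := Metric.mem_nhds_iff.1 h
  have key : ∀ r ∈ Metric.ball (1 : ℝ) ε, 1 ≤ |r| * ‖toPlane x‖ ∧ |r| * ‖toPlane x‖ ≤ 2 := by
    intro r hr
    obtain ⟨y, -, hy⟩ := hball hr
    have : (r : ℂ) * toPlane x ∈ Set.range toPlane := ⟨y, hy⟩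
    rw [range_toPlane] at this
    simpa using this
  have hε' : 0 < min ε 1 := lt_min hε one_pos
  have hle : min ε 1 ≤ 1 := min_le_right _ _
  have hle' : min ε 1 ≤ ε := min_le_left _ _
  intro hx
  rcases (mem_rim_iff x).1 hx with h1 | h1
  · have := (key (1 - min ε 1 / 2) (by
      rw [Metric.mem_ball, Real.dist_eq, abs_lt]; constructor <;> linarith)).1
    rw [abs_of_nonneg (by linarith), h1] at this
    linarith
  · have := (key (1 + min ε 1 / 2) (by
      rw [Metric.mem_ball, Real.dist_eq, abs_lt]; constructor <;> linarith)).2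
    rw [abs_of_nonneg (by linarith), h1] at this
    linarith

/-- Invariance of domain for maps from the plane to the cylinder. -/
theorem image_mem_nhds_of_injOn {f : ℂ → Cylinder} {U : Set ℂ} (hf : ContinuousOn f U)
    (hinj : Set.InjOn f U) {a : ℂ} (hU : U ∈ 𝓝 a) : f '' U ∈ 𝓝 (f a) ∧ f a ∉ rim := by
  have h := _root_.image_mem_nhds_of_injOn (f := fun z => toPlane (f z))
    (continuous_toPlane.comp_continuousOn hf) (injective_toPlane.comp_injOn hinj) hU
  have h' : toPlane '' (f '' U) ∈ 𝓝 (toPlane (f a)) := by rwa [Set.image_image]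
  refine ⟨?_, notMem_rim_of_image_mem_nhds h'⟩
  rw [isEmbedding_toPlane.nhds_eq_comap]
  exact ⟨_, h', by rw [Set.preimage_image_eq _ injective_toPlane]⟩

/-- Invariance of domain for maps from the interior of the cylinder to the plane. -/
theorem image_mem_nhds_of_injOn' {g : Cylinder → ℂ} {N : Set Cylinder} (hg : ContinuousOn g N)
    (hinj : Set.InjOn g N) {x : Cylinder} (hx : x ∉ rim) (hN : N ∈ 𝓝 x) : g '' N ∈ 𝓝 (g x) := by
  let r : ℂ → Cylinder := Function.invFunOn toPlane Set.univ
  have hr : ∀ y, r (toPlane y) = y := fun y =>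
    injective_toPlane.injOn.leftInvOn_invFunOn (Set.mem_univ y)
  have hrc : ContinuousOn r (Set.range toPlane) := by
    have := isCompact_univ.continuousOn_invFunOn continuous_toPlane.continuousOn
      injective_toPlane.injOn
    rwa [Set.image_univ] at this
  have h := _root_.image_mem_nhds_of_injOn (f := g ∘ r) (U := toPlane '' N)
    (hg.comp (hrc.mono (Set.image_subset_range _ _)) (by
      rintro _ ⟨y, hy, rfl⟩
      rwa [hr]))
    (by
      rintro _ ⟨y, hy, rfl⟩ _ ⟨z, hz, rfl⟩ h
      simp only [Function.comp_apply, hr] at h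
      rw [hinj hy hz h])
    (image_toPlane_mem_nhds hx hN)
  simp only [Function.comp_apply, hr] at h
  rw [Set.image_image] at h
  simpa only [Function.comp_apply, hr] using h

/-- Invariance of domain is available only off the rim; this moves a neighbourhood argument there.
-/
theorem exists_notMem_rim_of_mem_nhds {x : Cylinder} {N : Set Cylinder} (hN : N ∈ 𝓝 x) :
    ∃ y ∈ N, y ∉ rim ∧ N ∈ 𝓝 y := by
  obtain ⟨O, hON, hO, hxO⟩ := mem_nhds_iff.1 hN
  have hc : Continuous fun t : ℝ => (x.1, Set.projIcc (0 : ℝ) 1 zero_le_one t) := by fun_prop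
  have hxe : (x.1, Set.projIcc (0 : ℝ) 1 zero_le_one (x.2 : ℝ)) = x := by
    rw [Set.projIcc_val]
  have h := (hO.preimage hc).mem_nhds (x := (x.2 : ℝ)) (by
    rw [Set.mem_preimage, hxe]; exact hxO)
  obtain ⟨ε, hε, hball⟩ := Metric.mem_nhds_iff.1 h
  have h0 := x.2.2.1
  have h1 := x.2.2.2
  have hx01 : (x.2 : ℝ) ∈ closure (Set.Ioo (0 : ℝ) 1) := by
    rw [closure_Ioo zero_ne_one]; exact x.2.2
  obtain ⟨t, ht, htd⟩ := Metric.mem_closure_iff.1 hx01 ε hε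
  have hmem : (x.1, Set.projIcc (0 : ℝ) 1 zero_le_one t) ∈ O :=
    hball (by rwa [Metric.mem_ball, dist_comm])
  refine ⟨_, hON hmem, ?_, Filter.mem_of_superset (hO.mem_nhds hmem) hON⟩
  rw [mem_rim_iff, norm_toPlane]
  simp only [Set.projIcc_of_mem zero_le_one (Set.Ioo_subset_Icc_self ht)]
  rintro (h | h)
  · linarith [ht.1]
  · linarith [ht.2]

/-! ### Open and closed cells, their coordinates and incidences. -/

theorem const_mem_closedBall (s : ℝ) :
    (fun _ : Fin 1 => s) ∈ Metric.closedBall (0 : Fin 1 → ℝ) 1 ↔ s ∈ Set.Icc (-1 : ℝ) 1 := by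
  rw [mem_closedBall_zero_iff, pi_norm_const, Real.norm_eq_abs, abs_le, Set.mem_Icc]

theorem const_mem_ball (s : ℝ) :
    (fun _ : Fin 1 => s) ∈ Metric.ball (0 : Fin 1 → ℝ) 1 ↔ s ∈ Set.Ioo (-1 : ℝ) 1 := by
  rw [mem_ball_zero_iff, pi_norm_const, Real.norm_eq_abs, abs_lt, Set.mem_Ioo]

section Cells

variable [CWComplex (Set.univ : Set Cylinder)]

/-- The characteristic map of an edge, as a function on the line. -/
noncomputable def Edge.arc (e : Edge) (s : ℝ) : Cylinder :=
  RelCWComplex.map (C := Set.univ) 1 e fun _ => s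

/-- The open edge. -/
noncomputable def Edge.inner (e : Edge) : Set Cylinder :=
  RelCWComplex.openCell (C := Set.univ) 1 e

/-- The closed edge. -/
noncomputable def Edge.closed (e : Edge) : Set Cylinder :=
  RelCWComplex.closedCell (C := Set.univ) 1 e

/-- The open face. -/
noncomputable def Face.inner (f : Face) : Set Cylinder :=
  RelCWComplex.openCell (C := Set.univ) 2 f

/-- The closed face. -/
noncomputable def Face.closed (f : Face) : Set Cylinder :=
  RelCWComplex.closedCell (C := Set.univ) 2 f

/-- The vertex `v` is an endpoint of the edge `e`. -/
def Vertex.IsEnd (v : Vertex) (e : Edge) : Prop := v.pos ∈ e.closed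

/-- The underlying space of the graph of vertices and edges. -/
def graph : Set Cylinder := {x | (∃ v : Vertex, v.pos = x) ∨ ∃ e : Edge, x ∈ e.inner}

/-- The coordinate of a point of a closed edge. -/
noncomputable def Edge.coord (e : Edge) : Cylinder → ℝ :=
  Function.invFunOn e.arc (Set.Icc (-1) 1)

/-- The coordinates of a point of a closed face. -/
noncomputable def Face.coord (f : Face) : Cylinder → Fin 2 → ℝ :=
  Function.invFunOn (RelCWComplex.map (C := Set.univ) 2 f) (Metric.closedBall 0 1)

theorem Edge.closed_eq (e : Edge) : e.closed = e.arc '' Set.Icc (-1) 1 := by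
  ext x
  constructor
  · rintro ⟨u, hu, rfl⟩
    rw [eq_const_of_unique u] at hu ⊢
    exact ⟨_, (const_mem_closedBall _).1 hu, rfl⟩
  · rintro ⟨s, hs, rfl⟩
    exact ⟨_, (const_mem_closedBall s).2 hs, rfl⟩

theorem Edge.inner_eq (e : Edge) : e.inner = e.arc '' Set.Ioo (-1) 1 := by
  ext x
  constructor
  · rintro ⟨u, hu, rfl⟩
    rw [eq_const_of_unique u] at hu ⊢
    exact ⟨_, (const_mem_ball _).1 hu, rfl⟩
  · rintro ⟨s, hs, rfl⟩
    exact ⟨_, (const_mem_ball s).2 hs, rfl⟩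

theorem Edge.inner_subset_closed (e : Edge) : e.inner ⊆ e.closed :=
  RelCWComplex.openCell_subset_closedCell _ _

theorem Face.inner_subset_closed (f : Face) : f.inner ⊆ f.closed :=
  RelCWComplex.openCell_subset_closedCell _ _

theorem Edge.isClosed (e : Edge) : IsClosed e.closed := RelCWComplex.isClosed_closedCell

theorem Face.isClosed (f : Face) : IsClosed f.closed := RelCWComplex.isClosed_closedCell

theorem Edge.closure_inner (e : Edge) : closure e.inner = e.closed :=
  RelCWComplex.closure_openCell_eq_closedCell

theorem Face.closure_inner (f : Face) : closure f.inner = f.closed :=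
  RelCWComplex.closure_openCell_eq_closedCell

theorem Face.closed_eq (f : Face) : f.closed = f.boundary ∪ f.inner :=
  (RelCWComplex.cellFrontier_union_openCell_eq_closedCell (C := Set.univ) 2 f).symm

theorem Face.boundary_subset_closed (f : Face) : f.boundary ⊆ f.closed :=
  RelCWComplex.cellFrontier_subset_closedCell _ _

theorem Vertex.openCell_eq (v : Vertex) :
    RelCWComplex.openCell (C := Set.univ) 0 v = {v.pos} := by
  rw [RelCWComplex.openCell_zero_eq_singleton, Vertex.pos, Subsingleton.elim (0 : Fin 0 → ℝ) ![]]

theorem Vertex.pos_injective : Function.Injective (Vertex.pos : Vertex → Cylinder) := by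
  intro v w h
  apply RelCWComplex.openCell_congr (C := (Set.univ : Set Cylinder)) 0
  rw [Vertex.openCell_eq, Vertex.openCell_eq, h]

theorem Vertex.pos_notMem_edge_inner (v : Vertex) (e : Edge) : v.pos ∉ e.inner := by
  intro h
  have := RelCWComplex.disjoint_openCell_of_ne (C := (Set.univ : Set Cylinder)) (n := 0) (m := 1)
    (i := v) (j := e) (by simp)
  rw [Vertex.openCell_eq, Set.disjoint_singleton_left] at this
  exact this h

theorem Vertex.pos_notMem_face_inner (v : Vertex) (f : Face) : v.pos ∉ f.inner := by
  intro h
  have := RelCWComplex.disjoint_openCell_of_ne (C := (Set.univ : Set Cylinder)) (n := 0) (m := 2)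
    (i := v) (j := f) (by simp)
  rw [Vertex.openCell_eq, Set.disjoint_singleton_left] at this
  exact this h

theorem disjoint_edge_face (e : Edge) (f : Face) : Disjoint e.inner f.inner :=
  RelCWComplex.disjoint_openCell_of_ne (C := (Set.univ : Set Cylinder)) (by simp)

theorem Edge.eq_of_mem_inner {e e' : Edge} {x : Cylinder} (h : x ∈ e.inner) (h' : x ∈ e'.inner) :
    e = e' := by
  by_contra hne
  exact Set.disjoint_left.1 (RelCWComplex.disjoint_openCell_of_ne
    (C := (Set.univ : Set Cylinder)) (n := 1) (m := 1) (i := e) (j := e') (by simpa)) h h'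

theorem Face.eq_of_mem_inner {f f' : Face} {x : Cylinder} (h : x ∈ f.inner) (h' : x ∈ f'.inner) :
    f = f' := by
  by_contra hne
  exact Set.disjoint_left.1 (RelCWComplex.disjoint_openCell_of_ne
    (C := (Set.univ : Set Cylinder)) (n := 2) (m := 2) (i := f) (j := f') (by simpa)) h h'

theorem Face.boundary_subset_graph (f : Face) : f.boundary ⊆ graph := by
  intro x hx
  obtain ⟨I, hI⟩ := CWComplex.cellFrontier_subset_finite_openCell (C := (Set.univ : Set Cylinder))
    2 f
  have := hI hx
  simp only [Set.mem_iUnion] at this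
  obtain ⟨m, hm, j, -, hj⟩ := this
  interval_cases m
  · rw [Vertex.openCell_eq] at hj
    exact Or.inl ⟨j, hj.symm⟩
  · exact Or.inr ⟨j, hj⟩

theorem Face.boundary_disjoint_inner (f g : Face) : Disjoint f.boundary g.inner := by
  rw [Set.disjoint_left]
  intro x hx hg
  rcases f.boundary_subset_graph hx with ⟨v, rfl⟩ | ⟨e, he⟩
  · exact v.pos_notMem_face_inner g hg
  · exact Set.disjoint_left.1 (disjoint_edge_face e g) he hg

theorem Edge.exists_ends (e : Edge) :
    ∃ u v : Vertex, e.arc (-1) = u.pos ∧ e.arc 1 = v.pos := by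
  obtain ⟨I, hI⟩ := CWComplex.cellFrontier_subset_finite_openCell (C := (Set.univ : Set Cylinder))
    1 e
  have key : ∀ s : ℝ, |s| = 1 → ∃ u : Vertex, e.arc s = u.pos := by
    intro s hs
    have : e.arc s ∈ RelCWComplex.cellFrontier (C := Set.univ) 1 e :=
      ⟨fun _ => s, by rw [mem_sphere_zero_iff_norm, pi_norm_const, Real.norm_eq_abs, hs], rfl⟩
    have := hI this
    simp only [Set.mem_iUnion] at this
    obtain ⟨m, hm, j, -, hj⟩ := this
    interval_cases m
    rw [Vertex.openCell_eq] at hj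
    exact ⟨j, hj⟩
  obtain ⟨u, hu⟩ := key (-1) (by simp)
  obtain ⟨v, hv⟩ := key 1 (by simp)
  exact ⟨u, v, hu, hv⟩

theorem Edge.closed_subset_graph (e : Edge) : e.closed ⊆ graph := by
  rw [e.closed_eq]
  rintro _ ⟨s, hs, rfl⟩
  obtain ⟨u, v, hu, hv⟩ := e.exists_ends
  rcases hs.1.eq_or_lt with h | h
  · exact Or.inl ⟨u, by rw [← h, hu]⟩
  rcases hs.2.eq_or_lt with h' | h'
  · exact Or.inl ⟨v, by rw [h', hv]⟩
  · exact Or.inr ⟨e, by rw [e.inner_eq]; exact ⟨s, ⟨h, h'⟩, rfl⟩⟩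

theorem Edge.mem_inner_or_of_mem_closed {e : Edge} {x : Cylinder} (hx : x ∈ e.closed) :
    x ∈ e.inner ∨ ∃ v : Vertex, v.IsEnd e ∧ v.pos = x := by
  have hx' := hx
  rw [e.closed_eq] at hx'
  obtain ⟨s, hs, rfl⟩ := hx'
  obtain ⟨u, v, hu, hv⟩ := e.exists_ends
  rcases hs.1.eq_or_lt with h | h
  · exact Or.inr ⟨u, by rw [Vertex.IsEnd, ← hu, h]; exact hx, by rw [← h, hu]⟩
  rcases hs.2.eq_or_lt with h' | h'
  · exact Or.inr ⟨v, by rw [Vertex.IsEnd, ← hv, ← h']; exact hx, by rw [h', hv]⟩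
  · exact Or.inl (by rw [e.inner_eq]; exact ⟨s, ⟨h, h'⟩, rfl⟩)

theorem Edge.eq_of_mem_inner_of_mem_closed {e e' : Edge} {x : Cylinder} (h : x ∈ e.inner)
    (h' : x ∈ e'.closed) : e = e' := by
  rcases Edge.mem_inner_or_of_mem_closed h' with h' | ⟨v, -, rfl⟩
  · exact Edge.eq_of_mem_inner h h'
  · exact absurd h (v.pos_notMem_edge_inner e)

theorem Edge.closed_disjoint_inner (e : Edge) (f : Face) : Disjoint e.closed f.inner := by
  rw [Set.disjoint_left]
  intro x hx hf
  rcases e.closed_subset_graph hx with ⟨v, rfl⟩ | ⟨e', he'⟩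
  · exact v.pos_notMem_face_inner f hf
  · exact Set.disjoint_left.1 (disjoint_edge_face e' f) he' hf

theorem Edge.isConnected_inner (e : Edge) : IsPreconnected e.inner :=
  (convex_ball (0 : Fin 1 → ℝ) 1).isPreconnected.image _
    ((RelCWComplex.continuousOn (C := Set.univ) 1 e).mono Metric.ball_subset_closedBall)

theorem Edge.inner_nonempty (e : Edge) : e.inner.Nonempty :=
  RelCWComplex.openCell_nonempty (C := Set.univ) 1 e

theorem Edge.continuousOn_arc (e : Edge) : ContinuousOn e.arc (Set.Icc (-1) 1) :=
  (RelCWComplex.continuousOn (C := Set.univ) 1 e).comp (by fun_prop)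
    fun s hs => (const_mem_closedBall s).2 hs

theorem IsCellularDecomposition.finite_cell (hG : IsCellularDecomposition) (n : ℕ) :
    Finite (RelCWComplex.cell (Set.univ : Set Cylinder) n) :=
  hG.finite.finite_cell n

theorem IsCellularDecomposition.mem_graph_or (hG : IsCellularDecomposition) (x : Cylinder) :
    x ∈ graph ∨ ∃ f : Face, x ∈ f.inner := by
  have hx : x ∈ ⋃ (n : ℕ) (j : RelCWComplex.cell (Set.univ : Set Cylinder) n),
      RelCWComplex.openCell n j := by
    rw [CWComplex.iUnion_openCell_eq_complex]
    trivial
  simp only [Set.mem_iUnion] at hx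
  obtain ⟨n, j, hj⟩ := hx
  have hn : n ≤ 2 := by
    by_contra h
    exact (hG.dim_le_two n (by omega)).false j
  interval_cases n
  · rw [Vertex.openCell_eq] at hj
    exact Or.inl (Or.inl ⟨j, hj.symm⟩)
  · exact Or.inl (Or.inr ⟨j, hj⟩)
  · exact Or.inr ⟨j, hj⟩

theorem Edge.injOn_arc (e : Edge) (hG : IsCellularDecomposition) : Set.InjOn e.arc (Set.Icc (-1) 1) := by
  intro s hs t ht h
  exact congrFun (hG.regular 1 e ((const_mem_closedBall s).2 hs) ((const_mem_closedBall t).2 ht) h)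
    0

theorem Edge.continuousOn_coord (e : Edge) (hG : IsCellularDecomposition) : ContinuousOn e.coord e.closed := by
  rw [e.closed_eq]
  exact isCompact_Icc.continuousOn_invFunOn e.continuousOn_arc (e.injOn_arc hG)

theorem Edge.coord_mem (e : Edge) {x : Cylinder} (hx : x ∈ e.closed) :
    e.coord x ∈ Set.Icc (-1 : ℝ) 1 := by
  rw [e.closed_eq] at hx
  exact Function.invFunOn_mem hx

theorem Edge.arc_coord (e : Edge) {x : Cylinder} (hx : x ∈ e.closed) : e.arc (e.coord x) = x := by
  rw [e.closed_eq] at hx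
  exact Function.invFunOn_eq hx

theorem Edge.coord_arc (e : Edge) (hG : IsCellularDecomposition) {s : ℝ} (hs : s ∈ Set.Icc (-1 : ℝ) 1) :
    e.coord (e.arc s) = s :=
  (e.injOn_arc hG).leftInvOn_invFunOn hs

theorem Edge.injOn_coord (e : Edge) : Set.InjOn e.coord e.closed := by
  intro x hx y hy h
  rw [← e.arc_coord hx, h, e.arc_coord hy]

theorem Edge.coord_pos (e : Edge) {v : Vertex} (hv : v.IsEnd e) :
    e.coord v.pos = -1 ∨ e.coord v.pos = 1 := by
  have h := e.coord_mem hv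
  by_contra hne
  rw [not_or] at hne
  apply v.pos_notMem_edge_inner e
  rw [e.inner_eq]
  exact ⟨_, ⟨lt_of_le_of_ne h.1 (Ne.symm hne.1), lt_of_le_of_ne h.2 hne.2⟩, e.arc_coord hv⟩

/-- An edge has exactly two endpoints. -/
theorem Edge.exists_isEnd_iff (e : Edge) (hG : IsCellularDecomposition) :
    ∃ u v : Vertex, u ≠ v ∧ ∀ w : Vertex, w.IsEnd e ↔ w = u ∨ w = v := by
  obtain ⟨u, v, hu, hv⟩ := e.exists_ends
  refine ⟨u, v, ?_, fun w => ⟨fun hw => ?_, ?_⟩⟩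
  · rintro rfl
    have := e.injOn_arc hG (by norm_num) (by norm_num) (hu.trans hv.symm)
    norm_num at this
  · have := e.arc_coord hw
    rcases e.coord_pos hw with h | h
    · rw [h, hu] at this
      exact Or.inl (Vertex.pos_injective this.symm)
    · rw [h, hv] at this
      exact Or.inr (Vertex.pos_injective this.symm)
  · rintro (rfl | rfl)
    · rw [Vertex.IsEnd, e.closed_eq, ← hu]
      exact ⟨-1, by norm_num, rfl⟩
    · rw [Vertex.IsEnd, e.closed_eq, ← hv]
      exact ⟨1, by norm_num, rfl⟩

theorem Face.continuousOn_coord (f : Face) (hG : IsCellularDecomposition) : ContinuousOn f.coord f.closed :=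
  (isCompact_closedBall _ _).continuousOn_invFunOn
    (RelCWComplex.continuousOn (C := Set.univ) 2 f) (hG.regular 2 f)

theorem Face.map_coord (f : Face) {x : Cylinder} (hx : x ∈ f.closed) :
    RelCWComplex.map (C := Set.univ) 2 f (f.coord x) = x :=
  Function.invFunOn_eq hx

theorem Face.coord_mem (f : Face) {x : Cylinder} (hx : x ∈ f.closed) :
    f.coord x ∈ Metric.closedBall (0 : Fin 2 → ℝ) 1 :=
  Function.invFunOn_mem hx

theorem Face.injOn_coord (f : Face) : Set.InjOn f.coord f.closed := by
  intro x hx y hy h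
  rw [← f.map_coord hx, h, f.map_coord hy]

theorem Face.coord_mem_sphere (f : Face) (hG : IsCellularDecomposition) {x : Cylinder} (hx : x ∈ f.boundary) :
    f.coord x ∈ Metric.sphere (0 : Fin 2 → ℝ) 1 := by
  obtain ⟨u, hu, rfl⟩ := hx
  rwa [Face.coord, (hG.regular 2 f).leftInvOn_invFunOn (Metric.sphere_subset_closedBall hu)]

/-- Near a given point there are only the closed cells containing it. -/
theorem IsCellularDecomposition.eventually_mem (hG : IsCellularDecomposition) (x : Cylinder) :
    ∀ᶠ y in 𝓝 x, (∀ v : Vertex, v.pos = y → v.pos = x) ∧ (∀ e : Edge, y ∈ e.closed → x ∈ e.closed) ∧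
      ∀ f : Face, y ∈ f.closed → x ∈ f.closed := by
  have := hG.finite_cell 0
  have := hG.finite_cell 1
  have := hG.finite_cell 2
  refine Filter.Eventually.and ?_ (Filter.Eventually.and ?_ ?_)
  · refine Filter.eventually_all.2 fun v => ?_
    by_cases h : v.pos = x
    · exact Filter.Eventually.of_forall fun _ _ => h
    · filter_upwards [isOpen_compl_singleton.mem_nhds (Ne.symm h)] with y hy hv
      exact absurd hv.symm hy
  · refine Filter.eventually_all.2 fun e => ?_
    by_cases h : x ∈ e.closed
    · exact Filter.Eventually.of_forall fun _ _ => h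
    · filter_upwards [e.isClosed.isOpen_compl.mem_nhds h] with y hy hv
      exact absurd hv hy
  · refine Filter.eventually_all.2 fun f => ?_
    by_cases h : x ∈ f.closed
    · exact Filter.Eventually.of_forall fun _ _ => h
    · filter_upwards [f.isClosed.isOpen_compl.mem_nhds h] with y hy hv
      exact absurd hv hy

/-- An open edge is relatively open in the graph. -/
theorem Edge.eventually_mem_inner (e : Edge) (hG : IsCellularDecomposition) {x : Cylinder} (hx : x ∈ e.inner) :
    ∀ᶠ y in 𝓝 x, y ∈ graph → y ∈ e.inner := by
  filter_upwards [hG.eventually_mem x] with y hy hyg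
  rcases hyg with ⟨v, rfl⟩ | ⟨e', he'⟩
  · exact absurd (by rw [hy.1 v rfl]; exact hx) (v.pos_notMem_edge_inner e)
  · have := hy.2.1 e' (e'.inner_subset_closed he')
    rwa [Edge.eq_of_mem_inner_of_mem_closed hx this]

/-- A connected family of points of open edges stays in one edge. -/
theorem IsCellularDecomposition.exists_edge_of_isPreconnected (hG : IsCellularDecomposition) {A : Type*} [TopologicalSpace A]
    {γ : A → Cylinder} {S : Set A} (hS : IsPreconnected S) (hne : S.Nonempty)
    (hγ : ContinuousOn γ S) (h : ∀ a ∈ S, ∃ e : Edge, γ a ∈ e.inner) :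
    ∃ e : Edge, ∀ a ∈ S, γ a ∈ e.inner := by
  classical
  obtain ⟨a₀, ha₀⟩ := hne
  obtain ⟨e₀, he₀⟩ := h a₀ ha₀
  have : Nonempty Edge := ⟨e₀⟩
  choose! k hk using h
  -- For the discrete topology on edges, the edge containing `γ a` is a continuous function of `a`,
  -- because open edges are relatively open in the graph.
  let : TopologicalSpace Edge := ⊥
  have : DiscreteTopology Edge := ⟨rfl⟩
  have hkc : ContinuousOn k S := by
    intro a ha
    have h1 : ∀ᶠ b in 𝓝[S] a, γ b ∈ (k a).inner := by
      filter_upwards [(hγ a ha).eventually ((k a).eventually_mem_inner hG (hk a ha)),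
        self_mem_nhdsWithin] with b hb hbS
      exact hb (Or.inr ⟨_, hk b hbS⟩)
    refine (tendsto_const_nhds.congr' ?_ : Filter.Tendsto k (𝓝[S] a) (𝓝 (k a)))
    filter_upwards [h1, self_mem_nhdsWithin] with b hb hbS
    exact Edge.eq_of_mem_inner hb (hk b hbS)
  refine ⟨k a₀, fun a ha => ?_⟩
  rw [hS.constant hkc ha₀ ha]
  exact hk a ha

end Cells

end Cylinder

/-! ### Simple closed curves in the graph. -/

theorem Circle.eq_of_exp_eq_exp_of_abs_sub_lt {s t : ℝ} (h : Circle.exp s = Circle.exp t)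
    (hst : |s - t| < 2 * Real.pi) : s = t := by
  obtain ⟨m, hm⟩ := Circle.exp_eq_exp.1 h
  have hpi := Real.pi_pos
  rw [hm, add_sub_cancel_left, abs_mul, abs_of_pos (by positivity : 0 < 2 * Real.pi)] at hst
  have h1 : |(m : ℝ)| < 1 := by
    by_contra hc
    push Not at hc
    nlinarith
  have h2 : m = 0 := by
    rw [← Int.cast_abs] at h1
    exact Int.abs_lt_one_iff.1 (by exact_mod_cast h1)
  simp [hm, h2]

/-- A continuous injection of the circle maps neighbourhoods to neighbourhoods in its range. -/
theorem eventually_mem_image_of_circle {X : Type*} [TopologicalSpace X] [T2Space X]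
    {c : Circle → X} (hc : Continuous c) (hi : Function.Injective c) (t ε : ℝ) (hε : 0 < ε) :
    ∀ᶠ y in 𝓝 (c (Circle.exp t)), y ∈ Set.range c →
      ∃ s ∈ Set.Ioo (t - ε) (t + ε), c (Circle.exp s) = y := by
  have hemb := (hc.isClosedEmbedding hi).isEmbedding
  have h1 : Circle.exp '' Set.Ioo (t - ε) (t + ε) ∈ 𝓝 (Circle.exp t) :=
    isLocalHomeomorph_circleExp.isOpenMap.image_mem_nhds
      (Ioo_mem_nhds (by linarith) (by linarith))
  rw [hemb.nhds_eq_comap, Filter.mem_comap] at h1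
  obtain ⟨W, hW, hsub⟩ := h1
  filter_upwards [hW] with y hy
  rintro ⟨z, rfl⟩
  obtain ⟨s, hs, rfl⟩ := hsub hy
  exact ⟨s, hs, rfl⟩

namespace Cylinder

section Circuits

variable [CWComplex (Set.univ : Set Cylinder)]

/-- A circuit is a simple closed curve in the graph. -/
def IsCircuit (C : Set Cylinder) : Prop :=
  C ⊆ graph ∧ ∃ c : Circle → Cylinder, Continuous c ∧ Function.Injective c ∧ Set.range c = C

theorem IsCircuit.isClosed {C : Set Cylinder} (hC : IsCircuit C) : IsClosed C := by
  obtain ⟨-, c, hc, -, rfl⟩ := hC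
  exact (isCompact_range hc).isClosed

theorem IsCircuit.isPreconnected {C : Set Cylinder} (hC : IsCircuit C) : IsPreconnected C := by
  obtain ⟨-, c, hc, -, rfl⟩ := hC
  exact isPreconnected_range hc

theorem IsCircuit.nonempty {C : Set Cylinder} (hC : IsCircuit C) : C.Nonempty := by
  obtain ⟨-, c, hc, -, rfl⟩ := hC
  exact Set.range_nonempty c

/-- Locally, the coordinate of an edge along an injective path in the edge covers a neighbourhood. -/
theorem Edge.exists_image_coord_mem_nhds (e : Edge) (hG : IsCellularDecomposition)
    {c : Circle → Cylinder} (hc : Continuous c) (hi : Function.Injective c) {t ε : ℝ} (hε : 0 < ε)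
    (h : ∀ s ∈ Set.Ioo (t - ε) (t + ε), c (Circle.exp s) ∈ e.closed) :
    ∃ δ > 0, δ < ε ∧ (fun s => e.coord (c (Circle.exp s))) '' Set.Icc (t - δ) (t + δ) ∈
      𝓝 (e.coord (c (Circle.exp t))) := by
  have hpi := Real.pi_pos
  -- The bound `1` keeps the parameter interval shorter than `2π`, so that `Circle.exp` is injective
  -- on it.
  refine ⟨min (ε / 2) 1, lt_min (by linarith) one_pos,
    (min_le_left _ _).trans_lt (by linarith), ?_⟩
  have hδ1 : min (ε / 2) 1 ≤ 1 := min_le_right _ _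
  have hδ2 : min (ε / 2) 1 ≤ ε / 2 := min_le_left _ _
  set δ := min (ε / 2) 1
  have hmaps : ∀ s ∈ Set.Icc (t - δ) (t + δ), c (Circle.exp s) ∈ e.closed := fun s hs =>
    h s ⟨by linarith [hs.1], by linarith [hs.2]⟩
  refine image_Icc_mem_nhds_of_injOn (h := fun s => e.coord (c (Circle.exp s)))
    (lt_min (by linarith) one_pos)
    ((e.continuousOn_coord hG).comp (hc.comp Circle.exp.continuous).continuousOn hmaps) ?_
  intro a ha b hb hab
  refine Circle.eq_of_exp_eq_exp_of_abs_sub_lt (hi (e.injOn_coord (hmaps a ha) (hmaps b hb) hab)) ?_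
  have : Real.pi > 3 := Real.pi_gt_three
  rw [abs_lt]
  constructor <;> linarith [ha.1, ha.2, hb.1, hb.2]

/-- A circuit contains every closed edge whose interior it meets. -/
theorem IsCircuit.closed_subset {C : Set Cylinder} (hC : IsCircuit C)
    (hG : IsCellularDecomposition) {e : Edge} {x : Cylinder} (hxC : x ∈ C) (hxe : x ∈ e.inner) :
    e.closed ⊆ C := by
  have hclosed := hC.isClosed
  obtain ⟨hgraph, c, hc, hi, rfl⟩ := hC
  rw [← e.closure_inner]
  refine hclosed.closure_subset_iff.2 ?_
  have hsub : Set.Ioo (-1 : ℝ) 1 ⊆ Set.Icc (-1) 1 := Set.Ioo_subset_Icc_self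
  -- The points of the open edge on the circuit form an open set, by invariance of domain on the
  -- line, and so do the points off it, as the circuit is closed. The open edge is connected.
  have hO : IsOpen {s ∈ Set.Ioo (-1 : ℝ) 1 | e.arc s ∈ Set.range c} := by
    rw [isOpen_iff_mem_nhds]
    rintro s ⟨hs, z, hz⟩
    obtain ⟨t, rfl⟩ := Circle.exp_surjective z
    have h1 : c (Circle.exp t) ∈ e.inner := by
      rw [hz, e.inner_eq]
      exact ⟨s, hs, rfl⟩
    have h2 : ∀ᶠ r in 𝓝 t, c (Circle.exp r) ∈ e.inner := by
      filter_upwards [(hc.comp Circle.exp.continuous).continuousAt.eventually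
        (e.eventually_mem_inner hG h1)] with r hr
      exact hr (hgraph ⟨_, rfl⟩)
    obtain ⟨ε, hε, hball⟩ := Metric.eventually_nhds_iff_ball.1 h2
    rw [Real.ball_eq_Ioo] at hball
    obtain ⟨δ, -, hδε, hδ⟩ := e.exists_image_coord_mem_nhds hG hc hi hε
      fun s hs => e.inner_subset_closed (hball s hs)
    rw [hz, e.coord_arc hG (hsub hs)] at hδ
    filter_upwards [hδ, Ioo_mem_nhds hs.1 hs.2] with r hr hr'
    refine ⟨hr', ?_⟩
    obtain ⟨q, hq, rfl⟩ := hr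
    refine ⟨_, (e.arc_coord (e.inner_subset_closed (hball q ?_))).symm⟩
    exact ⟨by linarith [hq.1], by linarith [hq.2]⟩
  have hcl : IsClosed (Set.range c) := hclosed
  have hO' : IsOpen {s ∈ Set.Ioo (-1 : ℝ) 1 | e.arc s ∉ Set.range c} := by
    have := (e.continuousOn_arc.mono hsub).isOpen_inter_preimage isOpen_Ioo hcl.isOpen_compl
    exact this
  rw [e.inner_eq] at hxe ⊢
  obtain ⟨s, hs, rfl⟩ := hxe
  rintro _ ⟨r, hr, rfl⟩
  by_contra hrC
  obtain ⟨q, -, hq1, hq2⟩ := isPreconnected_Ioo _ _ hO hO'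
    (fun q hq => by
      by_cases h : e.arc q ∈ Set.range c
      · exact Or.inl ⟨hq, h⟩
      · exact Or.inr ⟨hq, h⟩)
    ⟨s, hs, hs, hxC⟩ ⟨r, hr, hr, hrC⟩
  exact hq2.2 hq1.2

/-- The shape of a circuit near one of its vertices: it runs along two distinct edges. -/
theorem exists_edges_of_circle (hG : IsCellularDecomposition) {c : Circle → Cylinder}
    (hc : Continuous c) (hi : Function.Injective c) (hgraph : Set.range c ⊆ graph) {v : Vertex}
    {t : ℝ} (ht : c (Circle.exp t) = v.pos) :
    ∃ ε > 0, ∃ e₁ e₂ : Edge, e₁ ≠ e₂ ∧ (∀ s ∈ Set.Ioo t (t + ε), c (Circle.exp s) ∈ e₁.inner) ∧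
      (∀ s ∈ Set.Ioo (t - ε) t, c (Circle.exp s) ∈ e₂.inner) ∧
      ∀ e : Edge, v.IsEnd e ∧ e.closed ⊆ Set.range c ↔ e = e₁ ∨ e = e₂ := by
  have hcirc : IsCircuit (Set.range c) := ⟨hgraph, c, hc, hi, rfl⟩
  have hγ : Continuous fun s => c (Circle.exp s) := hc.comp Circle.exp.continuous
  have hpi : Real.pi > 3 := Real.pi_gt_three
  have h1 : ∀ᶠ s in 𝓝 t, ∀ w : Vertex, w.pos = c (Circle.exp s) → w = v := by
    filter_upwards [hγ.continuousAt.eventually (hG.eventually_mem _)] with s hs w hw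
    exact Vertex.pos_injective ((hs.1 w hw).trans ht)
  obtain ⟨ε₀, hε₀, hball⟩ := Metric.eventually_nhds_iff_ball.1 h1
  rw [Real.ball_eq_Ioo] at hball
  obtain ⟨ε, hε, hεε₀, hε1⟩ : ∃ ε > 0, ε ≤ ε₀ ∧ ε ≤ 1 :=
    ⟨min ε₀ 1, lt_min hε₀ one_pos, min_le_left _ _, min_le_right _ _⟩
  have hedge : ∀ s ∈ Set.Ioo (t - ε) (t + ε), s ≠ t → ∃ e : Edge, c (Circle.exp s) ∈ e.inner := by
    intro s hs hst
    rcases hgraph ⟨Circle.exp s, rfl⟩ with ⟨w, hw⟩ | h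
    · exfalso
      have := hball s ⟨by linarith [hs.1], by linarith [hs.2]⟩ w hw
      rw [this, ← ht] at hw
      refine hst (Circle.eq_of_exp_eq_exp_of_abs_sub_lt (hi hw.symm) ?_)
      rw [abs_lt]
      constructor <;> linarith [hs.1, hs.2]
    · exact h
  obtain ⟨e₁, he₁⟩ := hG.exists_edge_of_isPreconnected (isPreconnected_Ioo (a := t) (b := t + ε))
    (Set.nonempty_Ioo.2 (by linarith)) hγ.continuousOn
    fun s hs => hedge s ⟨by linarith [hs.1], hs.2⟩ hs.1.ne'
  obtain ⟨e₂, he₂⟩ := hG.exists_edge_of_isPreconnected (isPreconnected_Ioo (a := t - ε) (b := t))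
    (Set.nonempty_Ioo.2 (by linarith)) hγ.continuousOn
    fun s hs => hedge s ⟨hs.1, by linarith [hs.2]⟩ hs.2.ne
  have hend₁ : v.IsEnd e₁ := by
    have : t ∈ closure (Set.Ioo t (t + ε)) := by
      rw [closure_Ioo (by linarith)]; exact ⟨le_rfl, by linarith⟩
    have := hγ.closure_preimage_subset e₁.inner (closure_mono he₁ this)
    rwa [Set.mem_preimage, e₁.closure_inner, ht] at this
  have hend₂ : v.IsEnd e₂ := by
    have : t ∈ closure (Set.Ioo (t - ε) t) := by
      rw [closure_Ioo (by linarith)]; exact ⟨by linarith, le_rfl⟩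
    have := hγ.closure_preimage_subset e₂.inner (closure_mono he₂ this)
    rwa [Set.mem_preimage, e₂.closure_inner, ht] at this
  refine ⟨ε, hε, e₁, e₂, ?_, he₁, he₂, fun e => ⟨?_, ?_⟩⟩
  · rintro rfl
    have hcl : ∀ s ∈ Set.Ioo (t - ε) (t + ε), c (Circle.exp s) ∈ e₁.closed := by
      intro s hs
      rcases lt_trichotomy s t with h | rfl | h
      · exact e₁.inner_subset_closed (he₂ s ⟨hs.1, h⟩)
      · rw [ht]
        exact hend₁
      · exact e₁.inner_subset_closed (he₁ s ⟨h, hs.2⟩)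
    -- If the curve entered and left along the same edge, the coordinate of that edge would cover a
    -- neighbourhood of an endpoint of `[-1, 1]` while staying inside the interval.
    obtain ⟨δ, -, hδε, hδ⟩ := e₁.exists_image_coord_mem_nhds hG hc hi hε hcl
    have hIcc : Set.Icc (-1 : ℝ) 1 ∈ 𝓝 (e₁.coord v.pos) := by
      rw [← ht]
      refine Filter.mem_of_superset hδ ?_
      rintro _ ⟨s, hs, rfl⟩
      exact e₁.coord_mem (hcl s ⟨by linarith [hs.1], by linarith [hs.2]⟩)
    rw [← mem_interior_iff_mem_nhds, interior_Icc] at hIcc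
    rcases e₁.coord_pos hend₁ with h | h
    · rw [h] at hIcc
      exact lt_irrefl _ hIcc.1
    · rw [h] at hIcc
      exact lt_irrefl _ hIcc.2
  · rintro ⟨hve, hec⟩
    have hcl : v.pos ∈ closure e.inner := by rw [e.closure_inner]; exact hve
    -- Points of `e` close to `v` lie on the curve, hence have parameters close to `t`, where only
    -- `e₁` and `e₂` occur.
    have hev := eventually_mem_image_of_circle hc hi t ε hε
    rw [ht] at hev
    obtain ⟨y, hye, hy⟩ := ((mem_closure_iff_frequently.1 hcl).and_eventually hev).exists
    obtain ⟨s, hs, rfl⟩ := hy (hec (e.inner_subset_closed hye))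
    rcases lt_trichotomy s t with h | rfl | h
    · exact Or.inr (Edge.eq_of_mem_inner hye (he₂ s ⟨hs.1, h⟩))
    · rw [ht] at hye
      exact absurd hye (v.pos_notMem_edge_inner e)
    · exact Or.inl (Edge.eq_of_mem_inner hye (he₁ s ⟨h, hs.2⟩))
  · rintro (rfl | rfl)
    · exact ⟨hend₁, hcirc.closed_subset hG ⟨_, rfl⟩
        (he₁ (t + ε / 2) ⟨by linarith, by linarith⟩)⟩
    · exact ⟨hend₂, hcirc.closed_subset hG ⟨_, rfl⟩
        (he₂ (t - ε / 2) ⟨by linarith, by linarith⟩)⟩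

/-- Every vertex of a circuit lies on exactly two of its edges. -/
theorem IsCircuit.exists_edges {C : Set Cylinder} (hC : IsCircuit C)
    (hG : IsCellularDecomposition) {v : Vertex} (hv : v.pos ∈ C) :
    ∃ e₁ e₂ : Edge, e₁ ≠ e₂ ∧ ∀ e : Edge, v.IsEnd e ∧ e.closed ⊆ C ↔ e = e₁ ∨ e = e₂ := by
  obtain ⟨hgraph, c, hc, hi, rfl⟩ := hC
  obtain ⟨z, hz⟩ := hv
  obtain ⟨t, rfl⟩ := Circle.exp_surjective z
  obtain ⟨ε, -, e₁, e₂, hne, -, -, h⟩ := exists_edges_of_circle hG hc hi hgraph hz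
  exact ⟨e₁, e₂, hne, h⟩

theorem IsCircuit.exists_vertex {C : Set Cylinder} (hC : IsCircuit C)
    (hG : IsCellularDecomposition) : ∃ v : Vertex, v.pos ∈ C := by
  obtain ⟨x, hx⟩ := hC.nonempty
  rcases hC.1 hx with ⟨v, rfl⟩ | ⟨e, he⟩
  · exact ⟨v, hx⟩
  · obtain ⟨u, _, -, huv⟩ := e.exists_isEnd_iff hG
    exact ⟨u, hC.closed_subset hG hx he ((huv u).2 (Or.inl rfl))⟩

/-- A property of the vertices of a circuit that is inherited along its edges holds for all of them
or for none. -/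
theorem IsCircuit.forall_of_exists {C : Set Cylinder} (hC : IsCircuit C)
    (hG : IsCellularDecomposition) {P : Vertex → Prop}
    (hP : ∀ e : Edge, e.closed ⊆ C → ∀ u v : Vertex, u.IsEnd e → v.IsEnd e → P u → P v)
    {v : Vertex} (hv : v.pos ∈ C) (hPv : P v) {w : Vertex} (hw : w.pos ∈ C) : P w := by
  have := hG.finite_cell 1
  by_contra hPw
  -- The edges of the circuit whose ends all satisfy `P`, and those whose ends all fail it, give two
  -- disjoint closed sets covering the connected set `C`.
  let A (Q : Vertex → Prop) : Set Cylinder :=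
    ⋃ e ∈ {e : Edge | e.closed ⊆ C ∧ ∀ u : Vertex, u.IsEnd e → Q u}, e.closed
  have hA : ∀ Q, IsClosed (A Q) := fun Q =>
    (Set.toFinite _).isClosed_biUnion fun e _ => e.isClosed
  have hcases : ∀ e : Edge, e.closed ⊆ C →
      (∀ u : Vertex, u.IsEnd e → P u) ∨ ∀ u : Vertex, u.IsEnd e → ¬ P u := by
    intro e he
    by_cases h : ∃ u : Vertex, u.IsEnd e ∧ P u
    · obtain ⟨u, hu, hPu⟩ := h
      exact Or.inl fun w hw => hP e he u w hu hw hPu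
    · push Not at h
      exact Or.inr h
  have hmem : ∀ Q : Vertex → Prop, (∀ e : Edge, e.closed ⊆ C → ∀ u v : Vertex, u.IsEnd e →
      v.IsEnd e → Q u → Q v) → ∀ u : Vertex, u.pos ∈ C → Q u → u.pos ∈ A Q := by
    intro Q hQ u hu hQu
    obtain ⟨e₁, _, -, h⟩ := hC.exists_edges hG hu
    obtain ⟨h1, h2⟩ := (h e₁).2 (Or.inl rfl)
    exact Set.mem_biUnion (show e₁ ∈ {e : Edge | e.closed ⊆ C ∧ ∀ u : Vertex, u.IsEnd e → Q u} from
      ⟨h2, fun w hw => hQ e₁ h2 u w h1 hw hQu⟩) h1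
  have hcover : C ⊆ A P ∪ A fun u => ¬ P u := by
    intro x hx
    obtain ⟨e, he, hxe⟩ : ∃ e : Edge, e.closed ⊆ C ∧ x ∈ e.closed := by
      rcases hC.1 hx with ⟨u, rfl⟩ | ⟨e, he⟩
      · obtain ⟨e₁, _, -, h⟩ := hC.exists_edges hG hx
        obtain ⟨h1, h2⟩ := (h e₁).2 (Or.inl rfl)
        exact ⟨e₁, h2, h1⟩
      · exact ⟨e, hC.closed_subset hG hx he, e.inner_subset_closed he⟩
    rcases hcases e he with h | h
    · exact Or.inl (Set.mem_biUnion (show e ∈ {e : Edge | _} from ⟨he, h⟩) hxe)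
    · exact Or.inr (Set.mem_biUnion (show e ∈ {e : Edge | _} from ⟨he, h⟩) hxe)
  obtain ⟨x, -, hx1, hx2⟩ := isPreconnected_closed_iff.1 hC.isPreconnected _ _ (hA P) (hA _) hcover
    ⟨_, hv, hmem P hP v hv hPv⟩
    ⟨_, hw, hmem (fun u => ¬ P u) (fun e he u v hu hv h hPv => h (hP e he v u hv hu hPv)) w hw hPw⟩
  simp only [A, Set.mem_iUnion] at hx1 hx2
  obtain ⟨e, ⟨-, he⟩, hxe⟩ := hx1
  obtain ⟨e', ⟨-, he'⟩, hxe'⟩ := hx2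
  obtain ⟨u, u', -, hu⟩ := e.exists_isEnd_iff hG
  rcases Edge.mem_inner_or_of_mem_closed hxe with h | ⟨y, hy, rfl⟩
  · obtain rfl := Edge.eq_of_mem_inner_of_mem_closed h hxe'
    exact he' u ((hu u).2 (Or.inl rfl)) (he u ((hu u).2 (Or.inl rfl)))
  · exact he' y hxe' (he y hy)

end Circuits

end Cylinder

/-! ### Parity on circuits: counting, matchings and alternating colourings. -/

/-- The function on the line with simple zeros at the translates of the points `τ w`. -/
noncomputable def sineProduct {ι : Type*} (S : Finset ι) (τ : ι → ℝ) (t : ℝ) : ℝ :=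
  ∏ w ∈ S, Real.sin ((t - τ w) / 2)

theorem continuous_sineProduct {ι : Type*} (S : Finset ι) (τ : ι → ℝ) :
    Continuous (sineProduct S τ) := by
  unfold sineProduct
  fun_prop

/-- A shift by `2π` negates every factor, so an even number of factors is needed. This is where
parity enters the alternating colouring. -/
theorem sineProduct_periodic {ι : Type*} {S : Finset ι} (hS : Even S.card) (τ : ι → ℝ) :
    Function.Periodic (sineProduct S τ) (2 * Real.pi) := by
  intro t
  have : ∀ w, Real.sin ((t + 2 * Real.pi - τ w) / 2) = -Real.sin ((t - τ w) / 2) := by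
    intro w
    rw [← Real.sin_add_pi]
    ring_nf
  simp only [sineProduct, this, Finset.prod_neg, hS.neg_one_pow, one_mul]

theorem sineProduct_eq_zero_iff {ι : Type*} {S : Finset ι} {τ : ι → ℝ} {t : ℝ} :
    sineProduct S τ t = 0 ↔ ∃ w ∈ S, Circle.exp t = Circle.exp (τ w) := by
  rw [sineProduct, Finset.prod_eq_zero_iff]
  refine exists_congr fun w => and_congr_right fun _ => ?_
  rw [Real.sin_eq_zero_iff, Circle.exp_eq_exp]
  refine exists_congr fun m => ⟨fun h => by linarith, fun h => by linarith⟩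

/-- The product of sines changes sign at its simple zeros. -/
theorem exists_sineProduct_mul_neg {ι : Type*} {S : Finset ι} {τ : ι → ℝ} {v : ι} (hv : v ∈ S)
    (hτ : ∀ w ∈ S, Circle.exp (τ v) = Circle.exp (τ w) → w = v) {ε : ℝ} (hε : 0 < ε) :
    ∃ δ > 0, δ < ε ∧ sineProduct S τ (τ v + δ) * sineProduct S τ (τ v - δ) < 0 := by
  classical
  -- The factor of `v` is odd about `τ v`, and the product of the others is nonzero there, so it has
  -- constant sign nearby.
  have hR : sineProduct (S.erase v) τ (τ v) ≠ 0 := by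
    rw [Ne, sineProduct_eq_zero_iff]
    rintro ⟨w, hw, h⟩
    exact (Finset.mem_erase.1 hw).1 (hτ w (Finset.mem_erase.1 hw).2 h)
  have hfac : ∀ t, sineProduct S τ t =
      Real.sin ((t - τ v) / 2) * sineProduct (S.erase v) τ t := fun t =>
    (Finset.mul_prod_erase S (fun w => Real.sin ((t - τ w) / 2)) hv).symm
  have hcont : Continuous fun δ : ℝ => sineProduct (S.erase v) τ (τ v + δ) *
      sineProduct (S.erase v) τ (τ v - δ) := by
    have := continuous_sineProduct (S.erase v) τ
    fun_prop
  have hpos : ∀ᶠ δ in 𝓝 (0 : ℝ), 0 < sineProduct (S.erase v) τ (τ v + δ) *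
      sineProduct (S.erase v) τ (τ v - δ) := by
    refine hcont.continuousAt.eventually (lt_mem_nhds ?_)
    simpa using hR
  obtain ⟨r, hr, hball⟩ := Metric.eventually_nhds_iff_ball.1 hpos
  have hm : 0 < min (min r ε) 1 := lt_min (lt_min hr hε) one_pos
  have h1 : min (min r ε) 1 ≤ r := (min_le_left _ _).trans (min_le_left _ _)
  have h2 : min (min r ε) 1 ≤ ε := (min_le_left _ _).trans (min_le_right _ _)
  have h3 : min (min r ε) 1 ≤ 1 := min_le_right _ _
  refine ⟨min (min r ε) 1 / 2, by linarith, by linarith, ?_⟩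
  set δ := min (min r ε) 1 / 2
  have hδ : 0 < δ := by simp only [δ]; linarith
  have hδ1 : δ < 1 := by simp only [δ]; linarith
  have hp := hball δ (by
    rw [Metric.mem_ball, dist_zero_right, Real.norm_eq_abs, abs_of_pos hδ]
    simp only [δ]
    linarith)
  have hsin : 0 < Real.sin (δ / 2) :=
    Real.sin_pos_of_pos_of_lt_pi (by linarith) (by linarith [Real.pi_gt_three])
  rw [hfac, hfac, show (τ v + δ - τ v) / 2 = δ / 2 by ring,
    show (τ v - δ - τ v) / 2 = -(δ / 2) by ring, Real.sin_neg]
  have := mul_pos (mul_pos hsin hsin) hp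
  linarith

namespace Cylinder

/-- The radial projection of the unit circle to the unit sphere of the maximum norm. -/
noncomputable def toSquare (z : Circle) : Fin 2 → ℝ :=
  ‖![(z : ℂ).re, (z : ℂ).im]‖⁻¹ • ![(z : ℂ).re, (z : ℂ).im]

theorem norm_vec_pos (z : Circle) : 0 < ‖![(z : ℂ).re, (z : ℂ).im]‖ := by
  rw [norm_pos_iff]
  intro h
  have h0 := congrFun h 0
  have h1 := congrFun h 1
  exact Circle.coe_ne_zero z (Complex.ext h0 h1)

theorem continuous_toSquare : Continuous toSquare := by
  have h : Continuous fun z : Circle => ![(z : ℂ).re, (z : ℂ).im] := by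
    fun_prop
  exact (h.norm.inv₀ fun z => (norm_vec_pos z).ne').smul h

theorem injective_toSquare : Function.Injective toSquare := by
  intro z w h
  have hz := norm_vec_pos z
  have hw := norm_vec_pos w
  have h0 := congrFun h 0
  have h1 := congrFun h 1
  simp only [toSquare, Pi.smul_apply, smul_eq_mul] at h0 h1
  set a := ‖![(z : ℂ).re, (z : ℂ).im]‖⁻¹ with ha
  set b := ‖![(w : ℂ).re, (w : ℂ).im]‖⁻¹ with hb
  have hapos : 0 < a := inv_pos.2 hz
  have hbpos : 0 < b := inv_pos.2 hw
  have hzw : (a : ℂ) * z = b * w := by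
    apply Complex.ext
    · simpa using h0
    · simpa using h1
  have hab : a = b := by
    have := congrArg norm hzw
    rwa [norm_mul, norm_mul, Circle.norm_coe, Circle.norm_coe, mul_one, mul_one,
      Complex.norm_real, Complex.norm_real, Real.norm_of_nonneg hapos.le,
      Real.norm_of_nonneg hbpos.le] at this
  rw [hab] at hzw
  exact Circle.coe_injective (mul_left_cancel₀ (by exact_mod_cast hbpos.ne') hzw)

theorem range_toSquare : Set.range toSquare = Metric.sphere 0 1 := by
  ext u
  rw [mem_sphere_zero_iff_norm]
  constructor
  · rintro ⟨z, rfl⟩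
    rw [toSquare, norm_smul, norm_inv, norm_norm, inv_mul_cancel₀ (norm_vec_pos z).ne']
  · intro hu
    let w : ℂ := ⟨u 0, u 1⟩
    have hw : w ≠ 0 := by
      intro h
      have : u = 0 := by
        ext i
        fin_cases i
        · exact congrArg Complex.re h
        · exact congrArg Complex.im h
      simp [this] at hu
    have hwn : 0 < ‖w‖ := norm_pos_iff.2 hw
    refine ⟨Circle.exp w.arg, ?_⟩
    have hwe : ((Circle.exp w.arg : Circle) : ℂ) = (‖w‖⁻¹ : ℝ) * w := by
      rw [Circle.coe_exp]
      conv_rhs => rw [← Complex.norm_mul_exp_arg_mul_I w]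
      rw [Complex.norm_mul, Complex.norm_real, norm_norm, Complex.norm_exp_ofReal_mul_I, mul_one,
        ← mul_assoc, ← Complex.ofReal_mul, inv_mul_cancel₀ hwn.ne', Complex.ofReal_one, one_mul]
    have hvec : ![((Circle.exp w.arg : Circle) : ℂ).re, ((Circle.exp w.arg : Circle) : ℂ).im] =
        ‖w‖⁻¹ • u := by
      rw [hwe, Complex.re_ofReal_mul, Complex.im_ofReal_mul]
      ext i
      fin_cases i <;> rfl
    rw [toSquare, hvec, norm_smul, hu, mul_one, norm_inv, norm_norm, inv_inv, smul_smul,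
      mul_inv_cancel₀ hwn.ne', one_smul]

section Circuits

variable [CWComplex (Set.univ : Set Cylinder)]

/-- A circuit has as many vertices as edges. -/
theorem IsCircuit.ncard_vertices {C : Set Cylinder} (hC : IsCircuit C)
    (hG : IsCellularDecomposition) : {v : Vertex | v.pos ∈ C}.ncard = length C := by
  classical
  have := hG.finite_cell 0
  have := hG.finite_cell 1
  let _ := Fintype.ofFinite Vertex
  let _ := Fintype.ofFinite Edge
  rw [length, Set.ncard_eq_toFinset_card', Set.ncard_eq_toFinset_card']
  refine Nat.eq_of_mul_eq_mul_right (two_pos) (Finset.card_mul_eq_card_mul Vertex.IsEnd ?_ ?_)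
  · intro v hv
    obtain ⟨e₁, e₂, hne, h⟩ := hC.exists_edges hG (by simpa using hv)
    rw [← Finset.card_pair hne]
    congr 1
    ext e
    have := h e
    simp only [Finset.mem_bipartiteAbove, Set.mem_toFinset, Set.mem_ofPred_eq, Finset.mem_insert,
      Finset.mem_singleton]
    rw [← this, and_comm]
    rfl
  · intro e he
    obtain ⟨u, v, hne, h⟩ := e.exists_isEnd_iff hG
    rw [← Finset.card_pair hne]
    congr 1
    ext w
    have he' : e.closed ⊆ C := Set.mem_toFinset.1 he
    simp only [Finset.mem_bipartiteBelow, Set.mem_toFinset, Set.mem_ofPred_eq, Finset.mem_insert,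
      Finset.mem_singleton]
    rw [← h w]
    exact ⟨fun hw => hw.2, fun hw => ⟨he' hw, hw⟩⟩

/-- A circuit with a perfect matching has even length. -/
theorem IsCircuit.even_length {C : Set Cylinder} (hC : IsCircuit C)
    (hG : IsCellularDecomposition) (R : Vertex → Edge → Prop)
    (hR : ∀ v e, R v e → v.IsEnd e) (hex : ∀ v : Vertex, v.pos ∈ C → ∃! e, R v e ∧ e.closed ⊆ C)
    (hiff : ∀ e : Edge, e.closed ⊆ C → ∀ u v : Vertex, u.IsEnd e → v.IsEnd e → R u e → R v e) :
    Even (length C) := by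
  classical
  have := hG.finite_cell 0
  have := hG.finite_cell 1
  let _ := Fintype.ofFinite Vertex
  let _ := Fintype.ofFinite Edge
  rw [← hC.ncard_vertices hG, Set.ncard_eq_toFinset_card']
  have := Finset.card_mul_eq_card_mul (s := {v : Vertex | v.pos ∈ C}.toFinset)
    (t := {e : Edge | e.closed ⊆ C ∧ ∃ v, R v e}.toFinset) (m := 1) (n := 2) R ?_ ?_
  · rw [mul_one] at this
    rw [this]
    exact even_two.mul_left _
  · intro v hv
    obtain ⟨e, ⟨he, heC⟩, hu⟩ := hex v (by simpa using hv)
    rw [Finset.card_eq_one]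
    refine ⟨e, ?_⟩
    ext e'
    simp only [Finset.mem_bipartiteAbove, Set.mem_toFinset, Set.mem_ofPred_eq,
      Finset.mem_singleton]
    exact ⟨fun h => hu e' ⟨h.2, h.1.1⟩, by rintro rfl; exact ⟨⟨heC, v, he⟩, he⟩⟩
  · intro e he
    obtain ⟨heC, x, hx⟩ : e.closed ⊆ C ∧ ∃ v, R v e := by simpa using he
    obtain ⟨u, v, hne, h⟩ := e.exists_isEnd_iff hG
    rw [← Finset.card_pair hne]
    congr 1
    ext w
    simp only [Finset.mem_bipartiteBelow, Set.mem_toFinset, Set.mem_ofPred_eq, Finset.mem_insert,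
      Finset.mem_singleton]
    rw [← h w]
    exact ⟨fun hw => hR _ _ hw.2, fun hw => ⟨heC hw, hiff e heC x w (hR _ _ hx) hw hx⟩⟩

/-- The edges of a circuit of even length can be coloured alternately in two colours. -/
theorem IsCircuit.exists_coloring {C : Set Cylinder} (hC : IsCircuit C)
    (hG : IsCellularDecomposition) (heven : Even (length C)) :
    ∃ χ : Edge → Prop, ∀ v : Vertex, ∀ e e' : Edge, v.IsEnd e → e.closed ⊆ C → v.IsEnd e' →
      e'.closed ⊆ C → e ≠ e' → (χ e ↔ ¬ χ e') := by
  classical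
  have := hG.finite_cell 0
  let _ := Fintype.ofFinite Vertex
  have hcard := hC.ncard_vertices hG
  obtain ⟨hgraph, c, hc, hi, rfl⟩ := hC
  rw [Set.ncard_eq_toFinset_card'] at hcard
  set S := {v : Vertex | v.pos ∈ Set.range c}.toFinset with hS
  have hτ : ∀ v : Vertex, ∃ t, v ∈ S → c (Circle.exp t) = v.pos := by
    intro v
    by_cases hv : v ∈ S
    · obtain ⟨z, hz⟩ : v.pos ∈ Set.range c := by simpa [hS] using hv
      obtain ⟨t, rfl⟩ := Circle.exp_surjective z
      exact ⟨t, fun _ => hz⟩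
    · exact ⟨0, fun h => absurd h hv⟩
  choose τ hτ using hτ
  -- `ψ` vanishes exactly at the parameters of the vertices and changes sign at each; having an even
  -- number of factors, it descends to the circle. Its constant sign on an open edge is the colour
  -- of the edge.
  set ψ := sineProduct S τ with hψ
  have hper : Function.Periodic ψ (2 * Real.pi) := sineProduct_periodic (hcard ▸ heven) τ
  have hψeq : ∀ s t, Circle.exp s = Circle.exp t → ψ s = ψ t := by
    intro s t h
    obtain ⟨m, rfl⟩ := Circle.exp_eq_exp.1 h
    exact hper.int_mul m t
  let Ψ : Circle → ℝ := fun z => ψ (Function.surjInv Circle.exp_surjective z)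
  have hΨ : ∀ t, Ψ (Circle.exp t) = ψ t := fun t => hψeq _ _ (Function.surjInv_eq _ _)
  have hΨc : Continuous Ψ := by
    rw [(Circle.isCoveringMap_exp.isQuotientMap Circle.exp_surjective).continuous_iff]
    exact (continuous_sineProduct S τ).congr fun t => (hΨ t).symm
  have hzero : ∀ t, ψ t = 0 → ∃ v : Vertex, v.pos = c (Circle.exp t) := by
    intro t ht
    obtain ⟨w, hw, h⟩ := sineProduct_eq_zero_iff.1 ht
    exact ⟨w, by rw [h, hτ w hw]⟩
  have hsign : ∀ e : Edge, e.closed ⊆ Set.range c → ∀ s t, c (Circle.exp s) ∈ e.inner →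
      c (Circle.exp t) ∈ e.inner → 0 < ψ s → 0 < ψ t := by
    intro e he s t hs ht hpos
    by_contra hneg
    push Not at hneg
    have hpre : IsPreconnected (c ⁻¹' e.inner) := by
      rw [← (hc.isClosedEmbedding hi).isEmbedding.isInducing.isPreconnected_image,
        Set.image_preimage_eq_of_subset (e.inner_subset_closed.trans he)]
      exact e.isConnected_inner
    obtain ⟨z, hz, hz0⟩ : (0 : ℝ) ∈ Ψ '' (c ⁻¹' e.inner) :=
      hpre.intermediate_value (a := Circle.exp t) (b := Circle.exp s) ht hs
        hΨc.continuousOn ⟨by rwa [hΨ], by rw [hΨ]; exact hpos.le⟩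
    obtain ⟨r, rfl⟩ := Circle.exp_surjective z
    rw [hΨ] at hz0
    obtain ⟨w, hw⟩ := hzero r hz0
    exact w.pos_notMem_edge_inner e (hw ▸ hz)
  let χ : Edge → Prop := fun e => ∃ t, c (Circle.exp t) ∈ e.inner ∧ 0 < ψ t
  have key : ∀ (e e' : Edge) (s s' : ℝ), e.closed ⊆ Set.range c → e'.closed ⊆ Set.range c →
      c (Circle.exp s) ∈ e.inner → c (Circle.exp s') ∈ e'.inner → ψ s * ψ s' < 0 →
      (χ e ↔ ¬ χ e') := by
    intro e e' s s' he he' hs hs' hmul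
    have h1 : χ e ↔ 0 < ψ s := ⟨fun ⟨t, ht, hpos⟩ => hsign e he t s ht hs hpos, fun h => ⟨s, hs, h⟩⟩
    have h2 : χ e' ↔ 0 < ψ s' :=
      ⟨fun ⟨t, ht, hpos⟩ => hsign e' he' t s' ht hs' hpos, fun h => ⟨s', hs', h⟩⟩
    rw [h1, h2]
    rcases mul_neg_iff.1 hmul with ⟨ha, hb⟩ | ⟨ha, hb⟩
    · exact ⟨fun _ => hb.not_gt, fun _ => ha⟩
    · exact ⟨fun h => absurd h ha.not_gt, fun h => absurd hb h⟩
  refine ⟨χ, fun v e e' hve he hve' he' hne => ?_⟩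
  have hvS : v ∈ S := by
    rw [hS, Set.mem_toFinset]
    exact he hve
  obtain ⟨ε, hε, e₁, e₂, -, h₁, h₂, hiff⟩ := exists_edges_of_circle hG hc hi hgraph (hτ v hvS)
  obtain ⟨δ, hδ, hδε, hmul⟩ := exists_sineProduct_mul_neg hvS (τ := τ) (fun w hw h =>
    Vertex.pos_injective (by rw [← hτ w hw, ← hτ v hvS, h])) hε
  have m₁ := h₁ (τ v + δ) ⟨by linarith, by linarith⟩
  have m₂ := h₂ (τ v - δ) ⟨by linarith, by linarith⟩
  rcases (hiff e).1 ⟨hve, he⟩ with rfl | rfl <;> rcases (hiff e').1 ⟨hve', he'⟩ with rfl | rfl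
  · exact absurd rfl hne
  · exact key _ _ _ _ he he' m₁ m₂ hmul
  · exact key _ _ _ _ he he' m₂ m₁ (by rwa [mul_comm])
  · exact absurd rfl hne

/-- The balls of the maximum norm on `Fin 2 → ℝ` are squares; `toSquare` parametrises the frontier
of the square by the circle, and regularity makes the composite injective. -/
theorem Face.isCircuit_boundary (f : Face) (hG : IsCellularDecomposition) :
    IsCircuit f.boundary := by
  have hsub : ∀ z, toSquare z ∈ Metric.closedBall (0 : Fin 2 → ℝ) 1 := fun z =>
    Metric.sphere_subset_closedBall (range_toSquare ▸ Set.mem_range_self z)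
  refine ⟨f.boundary_subset_graph, fun z => RelCWComplex.map (C := Set.univ) 2 f (toSquare z),
    (RelCWComplex.continuousOn (C := Set.univ) 2 f).comp_continuous continuous_toSquare hsub,
    fun z w h => injective_toSquare (hG.regular 2 f (hsub z) (hsub w) h), ?_⟩
  rw [Face.boundary, RelCWComplex.cellFrontier, ← range_toSquare, ← Set.range_comp]
  rfl

end Circuits

/-! ### The faces along an edge. -/

/-- The identification of the plane with `ℝ²`. -/
noncomputable def toVec (z : ℂ) : Fin 2 → ℝ := ![z.re, z.im]

/-- The identification of `ℝ²` with the plane. -/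
noncomputable def ofVec (u : Fin 2 → ℝ) : ℂ := (u 0 : ℂ) + u 1 * Complex.I

theorem continuous_toVec : Continuous toVec := by
  unfold toVec
  fun_prop

theorem continuous_ofVec : Continuous ofVec := by
  unfold ofVec
  fun_prop

theorem toVec_ofVec (u : Fin 2 → ℝ) : toVec (ofVec u) = u := by
  ext i
  fin_cases i <;> simp [toVec, ofVec]

theorem ofVec_toVec (z : ℂ) : ofVec (toVec z) = z := by
  simp [toVec, ofVec, Complex.re_add_im]

theorem injective_ofVec : Function.Injective ofVec :=
  Function.LeftInverse.injective toVec_ofVec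

theorem injective_toVec : Function.Injective toVec :=
  Function.LeftInverse.injective ofVec_toVec

/-- The open square. -/
def unitSquare : Set ℂ := {z | z.re ∈ Set.Ioo (-1 : ℝ) 1 ∧ z.im ∈ Set.Ioo (-1 : ℝ) 1}

theorem abs_im_lt_of_mem_unitSquare {z : ℂ} (hz : z ∈ unitSquare) : |z.im| < 1 :=
  abs_lt.2 hz.2

theorem isOpen_unitSquare : IsOpen unitSquare :=
  (isOpen_Ioo.preimage Complex.continuous_re).inter (isOpen_Ioo.preimage Complex.continuous_im)

section Local

variable [CWComplex (Set.univ : Set Cylinder)]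

/-- Open faces are open and do not meet the rim. -/
theorem Face.inner_mem_nhds (f : Face) (hG : IsCellularDecomposition) {x : Cylinder}
    (hx : x ∈ f.inner) : f.inner ∈ 𝓝 x ∧ x ∉ rim := by
  obtain ⟨u, hu, rfl⟩ := hx
  have hsub : Set.MapsTo toVec (toVec ⁻¹' Metric.ball 0 1) (Metric.closedBall 0 1) :=
    fun z hz => Metric.ball_subset_closedBall hz
  have := image_mem_nhds_of_injOn
    (f := fun z => RelCWComplex.map (C := Set.univ) 2 f (toVec z))
    (U := toVec ⁻¹' Metric.ball 0 1) (a := ofVec u)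
    ((RelCWComplex.continuousOn (C := Set.univ) 2 f).comp continuous_toVec.continuousOn hsub)
    (fun z hz w hw h => injective_toVec (hG.regular 2 f (hsub hz) (hsub hw) h))
    ((Metric.isOpen_ball.preimage continuous_toVec).mem_nhds (by
      rwa [Set.mem_preimage, toVec_ofVec]))
  rw [toVec_ofVec] at this
  refine ⟨Filter.mem_of_superset this.1 ?_, this.2⟩
  rintro _ ⟨z, hz, rfl⟩
  exact ⟨_, hz, rfl⟩

theorem Edge.closed_subset_boundary_iff {e : Edge} (f : Face) (hG : IsCellularDecomposition)
    {x : Cylinder} (hx : x ∈ e.inner) : e.closed ⊆ f.boundary ↔ x ∈ f.closed := by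
  constructor
  · intro h
    exact f.boundary_subset_closed (h (e.inner_subset_closed hx))
  · intro h
    rw [f.closed_eq] at h
    rcases h with h | h
    · exact (f.isCircuit_boundary hG).closed_subset hG h hx
    · exact absurd h (Set.disjoint_left.1 (disjoint_edge_face e f) hx)

/-- The half disc in a face along one of its edges. -/
noncomputable def halfDisc (e : Edge) (f : Face) (z : ℂ) : Cylinder :=
  RelCWComplex.map (C := Set.univ) 2 f ((1 - |z.im|) • f.coord (e.arc z.re))

theorem Edge.arc_mem_inner (e : Edge) {z : ℂ} (hz : z ∈ unitSquare) : e.arc z.re ∈ e.inner := by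
  rw [e.inner_eq]
  exact ⟨_, hz.1, rfl⟩

section HalfDisc

variable {e : Edge} {f : Face}

theorem norm_halfDisc_coord (hG : IsCellularDecomposition) (hef : e.closed ⊆ f.boundary) {z : ℂ}
    (hz : z ∈ unitSquare) : ‖(1 - |z.im|) • f.coord (e.arc z.re)‖ = 1 - |z.im| := by
  have h1 := f.coord_mem_sphere hG (hef (e.inner_subset_closed (e.arc_mem_inner hz)))
  rw [mem_sphere_zero_iff_norm] at h1
  rw [norm_smul, h1, mul_one,
    Real.norm_of_nonneg (by linarith [abs_im_lt_of_mem_unitSquare hz])]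

theorem halfDisc_coord_mem (hG : IsCellularDecomposition) (hef : e.closed ⊆ f.boundary) {z : ℂ}
    (hz : z ∈ unitSquare) :
    (1 - |z.im|) • f.coord (e.arc z.re) ∈ Metric.closedBall (0 : Fin 2 → ℝ) 1 := by
  rw [mem_closedBall_zero_iff, norm_halfDisc_coord hG hef hz]
  linarith [abs_nonneg z.im]

theorem continuousOn_halfDisc (hG : IsCellularDecomposition) (hef : e.closed ⊆ f.boundary) :
    ContinuousOn (halfDisc e f) unitSquare := by
  refine (RelCWComplex.continuousOn (C := Set.univ) 2 f).comp ?_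
    fun z hz => halfDisc_coord_mem hG hef hz
  have h1 : Continuous fun z : ℂ => 1 - |z.im| :=
    continuous_const.sub Complex.continuous_im.abs
  refine h1.continuousOn.smul ?_
  refine (f.continuousOn_coord hG).comp ((e.continuousOn_arc).comp
    Complex.continuous_re.continuousOn fun z hz => Set.Ioo_subset_Icc_self hz.1) fun z hz => ?_
  exact f.boundary_subset_closed (hef (e.inner_subset_closed (e.arc_mem_inner hz)))

/-- The norm in the square recovers `|z.im|`, the direction recovers the point of the edge. The sign
of `z.im` is lost; it is left free to select one of two faces. -/
theorem halfDisc_inj (hG : IsCellularDecomposition) (hef : e.closed ⊆ f.boundary) {z w : ℂ}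
    (hz : z ∈ unitSquare) (hw : w ∈ unitSquare) (h : halfDisc e f z = halfDisc e f w) :
    z.re = w.re ∧ |z.im| = |w.im| := by
  have h1 := hG.regular 2 f (halfDisc_coord_mem hG hef hz) (halfDisc_coord_mem hG hef hw) h
  have h2 : |z.im| = |w.im| := by
    have := congrArg norm h1
    rw [norm_halfDisc_coord hG hef hz, norm_halfDisc_coord hG hef hw] at this
    linarith
  refine ⟨?_, h2⟩
  rw [h2] at h1
  have hne : (1 - |w.im|) ≠ 0 := by linarith [abs_im_lt_of_mem_unitSquare hw]
  have h3 := smul_right_injective _ hne h1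
  have hcl : ∀ {z : ℂ}, z ∈ unitSquare → e.arc z.re ∈ f.closed := fun hz =>
    f.boundary_subset_closed (hef (e.inner_subset_closed (e.arc_mem_inner hz)))
  exact e.injOn_arc hG (Set.Ioo_subset_Icc_self hz.1) (Set.Ioo_subset_Icc_self hw.1)
    (f.injOn_coord (hcl hz) (hcl hw) h3)

theorem halfDisc_of_im_eq_zero (hef : e.closed ⊆ f.boundary) {z : ℂ}
    (hz : z ∈ unitSquare) (h : z.im = 0) : halfDisc e f z = e.arc z.re := by
  rw [halfDisc, h, abs_zero, sub_zero, one_smul]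
  exact f.map_coord (f.boundary_subset_closed (hef (e.inner_subset_closed (e.arc_mem_inner hz))))

theorem halfDisc_mem_inner (hG : IsCellularDecomposition) (hef : e.closed ⊆ f.boundary) {z : ℂ}
    (hz : z ∈ unitSquare) (h : z.im ≠ 0) : halfDisc e f z ∈ f.inner := by
  refine ⟨_, ?_, rfl⟩
  rw [mem_ball_zero_iff, norm_halfDisc_coord hG hef hz]
  linarith [abs_pos.2 h]

end HalfDisc

/-- Two faces along an edge fill a neighbourhood of each interior point of the edge. -/
theorem exists_nhds_of_two_faces (hG : IsCellularDecomposition) {e : Edge} {f f' : Face}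
    (hne : f ≠ f') (hef : e.closed ⊆ f.boundary) (hef' : e.closed ⊆ f'.boundary) {x : Cylinder}
    (hx : x ∈ e.inner) : e.inner ∪ f.inner ∪ f'.inner ∈ 𝓝 x ∧ x ∉ rim := by
  classical
  -- The upper half of the square goes into `f`, the lower half into `f'`, and the real axis onto
  -- `e`. The halves agree on the axis and the three cells are disjoint, so invariance of domain
  -- applies.
  let Φ : ℂ → Cylinder := fun z => if 0 ≤ z.im then halfDisc e f z else halfDisc e f' z
  have hpos : ∀ z ∈ unitSquare, 0 < z.im → Φ z = halfDisc e f z ∧ Φ z ∈ f.inner := by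
    intro z hz h
    have : Φ z = halfDisc e f z := if_pos h.le
    exact ⟨this, this ▸ halfDisc_mem_inner hG hef hz h.ne'⟩
  have hneg : ∀ z ∈ unitSquare, z.im < 0 → Φ z = halfDisc e f' z ∧ Φ z ∈ f'.inner := by
    intro z hz h
    have : Φ z = halfDisc e f' z := if_neg h.not_ge
    exact ⟨this, this ▸ halfDisc_mem_inner hG hef' hz h.ne⟩
  have hzero : ∀ z ∈ unitSquare, z.im = 0 → Φ z = e.arc z.re ∧ Φ z ∈ e.inner := by
    intro z hz h
    have : Φ z = e.arc z.re := (if_pos h.ge).trans (halfDisc_of_im_eq_zero hef hz h)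
    exact ⟨this, this ▸ e.arc_mem_inner hz⟩
  have hcont : ContinuousOn Φ unitSquare := by
    refine ContinuousOn.if ?_ ((continuousOn_halfDisc hG hef).mono Set.inter_subset_left)
      ((continuousOn_halfDisc hG hef').mono Set.inter_subset_left)
    rintro z ⟨hz, hfr⟩
    have h0 : z.im = 0 := (frontier_le_subset_eq continuous_const Complex.continuous_im hfr).symm
    rw [halfDisc_of_im_eq_zero hef hz h0, halfDisc_of_im_eq_zero hef' hz h0]
  have hinj : Set.InjOn Φ unitSquare := by
    intro z hz w hw h
    rcases lt_trichotomy z.im 0 with h1 | h1 | h1 <;> rcases lt_trichotomy w.im 0 with h2 | h2 | h2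
    · have := halfDisc_inj hG hef' hz hw (by rwa [← (hneg z hz h1).1, ← (hneg w hw h2).1])
      rw [abs_of_neg h1, abs_of_neg h2] at this
      exact Complex.ext this.1 (by linarith)
    · exact absurd (h ▸ (hneg z hz h1).2)
        (Set.disjoint_left.1 (disjoint_edge_face e f') (hzero w hw h2).2)
    · exact absurd (Face.eq_of_mem_inner (h ▸ (hneg z hz h1).2) (hpos w hw h2).2) hne.symm
    · exact absurd (h ▸ (hneg w hw h2).2)
        (Set.disjoint_left.1 (disjoint_edge_face e f') (hzero z hz h1).2)
    · have := (hzero z hz h1).1.symm.trans (h.trans (hzero w hw h2).1)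
      exact Complex.ext (e.injOn_arc hG (Set.Ioo_subset_Icc_self hz.1)
        (Set.Ioo_subset_Icc_self hw.1) this) (h1.trans h2.symm)
    · exact absurd (h ▸ (hpos w hw h2).2)
        (Set.disjoint_left.1 (disjoint_edge_face e f) (hzero z hz h1).2)
    · exact absurd (Face.eq_of_mem_inner (h ▸ (hpos z hz h1).2) (hneg w hw h2).2) hne
    · exact absurd (h ▸ (hpos z hz h1).2)
        (Set.disjoint_left.1 (disjoint_edge_face e f) (hzero w hw h2).2)
    · have := halfDisc_inj hG hef hz hw (by rwa [← (hpos z hz h1).1, ← (hpos w hw h2).1])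
      rw [abs_of_pos h1, abs_of_pos h2] at this
      exact Complex.ext this.1 this.2
  rw [e.inner_eq] at hx
  obtain ⟨s, hs, rfl⟩ := hx
  have hsq : (s : ℂ) ∈ unitSquare := ⟨by simpa using hs, by simp⟩
  have := image_mem_nhds_of_injOn hcont hinj (isOpen_unitSquare.mem_nhds hsq)
  rw [(hzero _ hsq (by simp)).1, Complex.ofReal_re] at this
  refine ⟨Filter.mem_of_superset this.1 ?_, this.2⟩
  rintro _ ⟨z, hz, rfl⟩
  rcases lt_trichotomy z.im 0 with h1 | h1 | h1
  · exact Or.inr (hneg z hz h1).2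
  · exact Or.inl (Or.inl (hzero z hz h1).2)
  · exact Or.inl (Or.inr (hpos z hz h1).2)

/-- The closed edge and its faces form a neighbourhood of each interior point of the edge. -/
theorem Edge.eventually_mem_star (e : Edge) (hG : IsCellularDecomposition) {x : Cylinder}
    (hx : x ∈ e.inner) :
    ∀ᶠ y in 𝓝 x, y ∈ e.inner ∨ ∃ f : Face, e.closed ⊆ f.boundary ∧ y ∈ f.inner := by
  filter_upwards [hG.eventually_mem x, e.eventually_mem_inner hG hx] with y hy hye
  rcases hG.mem_graph_or y with h | ⟨f, hf⟩
  · exact Or.inl (hye h)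
  · exact Or.inr ⟨f, (Edge.closed_subset_boundary_iff f hG hx).2
      (hy.2.2 f (f.inner_subset_closed hf)), hf⟩

/-- Every edge lies on the boundary of some face. -/
theorem Edge.exists_face (e : Edge) (hG : IsCellularDecomposition) :
    ∃ f : Face, e.closed ⊆ f.boundary := by
  by_contra hno
  push Not at hno
  obtain ⟨x, hx⟩ := e.inner_nonempty
  -- Without faces the arc would be a neighbourhood of some point off the rim, and its coordinate
  -- would map that onto a plane neighbourhood contained in the real line.
  have hN : e.closed ∈ 𝓝 x := by
    filter_upwards [e.eventually_mem_star hG hx] with y hy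
    rcases hy with h | ⟨f, hf, -⟩
    · exact e.inner_subset_closed h
    · exact absurd hf (hno f)
  obtain ⟨y, -, hyr, hy⟩ := exists_notMem_rim_of_mem_nhds hN
  have h := image_mem_nhds_of_injOn' (g := fun x => ((e.coord x : ℝ) : ℂ))
    (Complex.continuous_ofReal.comp_continuousOn (e.continuousOn_coord hG))
    (fun a ha b hb h => e.injOn_coord ha hb (Complex.ofReal_injective h)) hyr hy
  have hc : Continuous fun r : ℝ => ((e.coord y : ℝ) : ℂ) + r * Complex.I := by fun_prop
  have h' := hc.continuousAt.preimage_mem_nhds (x := 0) (by simpa using h)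
  obtain ⟨ε, hε, hball⟩ := Metric.mem_nhds_iff.1 h'
  obtain ⟨z, -, hz⟩ := hball (show ε / 2 ∈ Metric.ball (0 : ℝ) ε by
    rw [Metric.mem_ball, dist_zero_right, Real.norm_of_nonneg] <;> linarith)
  have := congrArg Complex.im hz
  simp at this
  linarith

/-- An edge in the interior of the cylinder lies on at least two faces. -/
theorem Edge.exists_face_ne (e : Edge) (hG : IsCellularDecomposition) {x : Cylinder}
    (hx : x ∈ e.inner) (hxr : x ∉ rim) {f : Face} (hef : e.closed ⊆ f.boundary) :
    ∃ f' : Face, e.closed ⊆ f'.boundary ∧ f ≠ f' := by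
  by_contra hno
  push Not at hno
  -- With `f` as the only face, `f.closed` would be a neighbourhood of `x`, and invariance of domain
  -- would put `f.coord x` in the interior of the square although it lies on the frontier.
  have hN : f.closed ∈ 𝓝 x := by
    filter_upwards [e.eventually_mem_star hG hx] with y hy
    rcases hy with h | ⟨f', hf', hy⟩
    · exact f.boundary_subset_closed (hef (e.inner_subset_closed h))
    · rw [hno f' hf']
      exact f'.inner_subset_closed hy
  have h := image_mem_nhds_of_injOn' (g := fun x => ofVec (f.coord x))
    (continuous_ofVec.comp_continuousOn (f.continuousOn_coord hG))
    (fun a ha b hb h => f.injOn_coord ha hb (injective_ofVec h)) hxr hN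
  have h' := continuous_ofVec.continuousAt.preimage_mem_nhds h
  have hball : Metric.closedBall (0 : Fin 2 → ℝ) 1 ∈ 𝓝 (f.coord x) := by
    refine Filter.mem_of_superset h' ?_
    rintro u ⟨y, hy, hyu⟩
    rw [← injective_ofVec hyu]
    exact f.coord_mem hy
  rw [← mem_interior_iff_mem_nhds, interior_closedBall _ one_ne_zero] at hball
  have := f.coord_mem_sphere hG (hef (e.inner_subset_closed hx))
  rw [mem_sphere_zero_iff_norm] at this
  rw [mem_ball_zero_iff] at hball
  linarith

theorem rim_subset_graph (hG : IsCellularDecomposition) : (rim : Set Cylinder) ⊆ graph := by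
  intro x hx
  rcases hG.mem_graph_or x with h | ⟨f, hf⟩
  · exact h
  · exact absurd hx (f.inner_mem_nhds hG hf).2

theorem isCircuit_circleAt (hG : IsCellularDecomposition) {t : unitInterval}
    (ht : circleAt t ⊆ rim) : IsCircuit (circleAt t) := by
  refine ⟨ht.trans (rim_subset_graph hG), fun z => (z, t), by fun_prop, fun z w h =>
    congrArg Prod.fst h, ?_⟩
  ext x
  exact ⟨fun ⟨z, hz⟩ => hz ▸ rfl, fun hx => ⟨x.1, Prod.ext rfl (Eq.symm hx)⟩⟩

theorem Edge.closed_subset_rim (e : Edge) (hG : IsCellularDecomposition) {x : Cylinder}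
    (hx : x ∈ e.inner) (hxr : x ∈ rim) : e.closed ⊆ rim := by
  rcases hxr with h | h
  · exact ((isCircuit_circleAt hG Set.subset_union_left).closed_subset hG h hx).trans
      Set.subset_union_left
  · exact ((isCircuit_circleAt hG Set.subset_union_right).closed_subset hG h hx).trans
      Set.subset_union_right

/-- An edge of the rim lies on exactly one face. -/
theorem Edge.exists_face_iff_of_rim (e : Edge) (hG : IsCellularDecomposition)
    (her : e.closed ⊆ rim) : ∃ f : Face, ∀ g : Face, e.closed ⊆ g.boundary ↔ g = f := by
  obtain ⟨f, hf⟩ := e.exists_face hG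
  refine ⟨f, fun g => ⟨fun hg => ?_, fun h => h ▸ hf⟩⟩
  by_contra hne
  obtain ⟨x, hx⟩ := e.inner_nonempty
  exact (exists_nhds_of_two_faces hG hne hg hf hx).2 (her (e.inner_subset_closed hx))

/-- An edge off the rim lies on exactly two faces. -/
theorem Edge.exists_faces_iff (e : Edge) (hG : IsCellularDecomposition)
    (her : ¬ e.closed ⊆ rim) :
    ∃ f f' : Face, f ≠ f' ∧ ∀ g : Face, e.closed ⊆ g.boundary ↔ g = f ∨ g = f' := by
  obtain ⟨x, hx⟩ := e.inner_nonempty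
  have hxr : x ∉ rim := fun h => her (e.closed_subset_rim hG hx h)
  obtain ⟨f, hf⟩ := e.exists_face hG
  obtain ⟨f', hf', hne⟩ := e.exists_face_ne hG hx hxr hf
  refine ⟨f, f', hne, fun g => ⟨fun hg => ?_, by rintro (rfl | rfl) <;> assumption⟩⟩
  -- A third face would accumulate at `x`, but the first two and the edge already fill a
  -- neighbourhood.
  have hN := (exists_nhds_of_two_faces hG hne hf hf' hx).1
  have hcl : x ∈ closure g.inner := by
    rw [g.closure_inner]
    exact g.boundary_subset_closed (hg (e.inner_subset_closed hx))
  obtain ⟨y, hyN, hyg⟩ := mem_closure_iff_nhds.1 hcl _ hN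
  rcases hyN with (h | h) | h
  · exact absurd hyg (Set.disjoint_left.1 (disjoint_edge_face e g) h)
  · exact Or.inl (Face.eq_of_mem_inner hyg h)
  · exact Or.inr (Face.eq_of_mem_inner hyg h)

end Local

/-! ### Sides of edges and vertices; the local picture at a cubic vertex. -/

theorem disjoint_circleAt : Disjoint (circleAt 0) (circleAt 1) := by
  rw [Set.disjoint_left]
  intro x h0 h1
  exact zero_ne_one (α := unitInterval) ((show x.2 = 0 from h0).symm.trans h1)

theorem circleAt_subset_rim {t : unitInterval} (ht : t = 0 ∨ t = 1) : circleAt t ⊆ rim := by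
  rcases ht with rfl | rfl
  · exact Set.subset_union_left
  · exact Set.subset_union_right

section Sides

variable [CWComplex (Set.univ : Set Cylinder)]

/-- The edge `e` lies on the boundary of a face, or of the outside `none` of the cylinder. -/
def Edge.On (e : Edge) : Option Face → Prop
  | none => e.closed ⊆ rim
  | some f => e.closed ⊆ f.boundary

/-- The vertex `v` lies on the boundary of a face, or of the outside `none` of the cylinder. -/
def Vertex.On (v : Vertex) : Option Face → Prop
  | none => v.pos ∈ rim
  | some f => v.pos ∈ f.boundary

theorem Edge.On.vertex {e : Edge} {g : Option Face} (h : e.On g) {v : Vertex} (hv : v.IsEnd e) :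
    v.On g := by
  cases g <;> exact h hv

/-- Every edge has exactly two sides. -/
theorem Edge.exists_sides (e : Edge) (hG : IsCellularDecomposition) :
    ∃ g g' : Option Face, g ≠ g' ∧ ∀ h, e.On h ↔ h = g ∨ h = g' := by
  by_cases her : e.closed ⊆ rim
  · obtain ⟨f, hf⟩ := e.exists_face_iff_of_rim hG her
    refine ⟨none, some f, by simp, ?_⟩
    rintro (_ | g)
    · simpa [Edge.On] using her
    · simpa [Edge.On] using hf g
  · obtain ⟨f, f', hne, hf⟩ := e.exists_faces_iff hG her
    refine ⟨some f, some f', by simpa, ?_⟩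
    rintro (_ | g)
    · simpa [Edge.On] using her
    · simpa [Edge.On] using hf g

theorem Edge.closed_subset_circleAt (e : Edge) (hG : IsCellularDecomposition)
    (he : e.closed ⊆ rim) {v : Vertex} (hv : v.IsEnd e) {t : unitInterval} (ht : t = 0 ∨ t = 1)
    (hvt : v.pos ∈ circleAt t) : e.closed ⊆ circleAt t := by
  obtain ⟨x, hx⟩ := e.inner_nonempty
  rcases he (e.inner_subset_closed hx) with h | h
  · have := (isCircuit_circleAt hG Set.subset_union_left).closed_subset hG h hx
    rcases ht with rfl | rfl
    · exact this
    · exact absurd hvt (Set.disjoint_left.1 disjoint_circleAt (this hv))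
  · have := (isCircuit_circleAt hG Set.subset_union_right).closed_subset hG h hx
    rcases ht with rfl | rfl
    · exact absurd (this hv) (Set.disjoint_left.1 disjoint_circleAt hvt)
    · exact this

/-- Exactly two edges at a vertex lie on a given side at that vertex. -/
theorem Vertex.exists_edges_on {v : Vertex} (hG : IsCellularDecomposition) {g : Option Face}
    (hv : v.On g) :
    ∃ e₁ e₂ : Edge, e₁ ≠ e₂ ∧ ∀ e : Edge, v.IsEnd e ∧ e.On g ↔ e = e₁ ∨ e = e₂ := by
  cases g with
  | some f => exact (f.isCircuit_boundary hG).exists_edges hG hv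
  | none =>
    obtain ⟨t, ht, hvt⟩ : ∃ t : unitInterval, (t = 0 ∨ t = 1) ∧ v.pos ∈ circleAt t := by
      rcases hv with h | h
      · exact ⟨0, Or.inl rfl, h⟩
      · exact ⟨1, Or.inr rfl, h⟩
    obtain ⟨e₁, e₂, hne, h⟩ := (isCircuit_circleAt hG (circleAt_subset_rim ht)).exists_edges hG hvt
    refine ⟨e₁, e₂, hne, fun e => ?_⟩
    rw [← h e]
    exact and_congr_right fun hve =>
      ⟨fun he => e.closed_subset_circleAt hG he hve ht hvt,
        fun he => he.trans (circleAt_subset_rim ht)⟩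

theorem Vertex.isEnd_iff_mem_cellFrontier (v : Vertex) (e : Edge) :
    v.IsEnd e ↔ v.pos ∈ RelCWComplex.cellFrontier (C := Set.univ) 1 e := by
  constructor
  · intro h
    have h' := h
    rw [Vertex.IsEnd, Edge.closed, ← RelCWComplex.cellFrontier_union_openCell_eq_closedCell] at h'
    exact h'.resolve_right (v.pos_notMem_edge_inner e)
  · intro h
    exact RelCWComplex.cellFrontier_subset_closedCell _ _ h

/-- The structure at a vertex of degree three: three edges and three sides, where each side misses
exactly one edge. -/
theorem Vertex.exists_local (v : Vertex) (hG : IsCellularDecomposition) (hdeg : v.degree = 3) :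
    ∃ (E : Fin 3 → Edge) (g : Fin 3 → Option Face), Function.Injective E ∧ Function.Injective g ∧
      (∀ e : Edge, v.IsEnd e ↔ ∃ i, E i = e) ∧ (∀ h, v.On h ↔ ∃ i, g i = h) ∧
      ∀ i j, (E i).On (g j) ↔ i ≠ j := by
  classical
  have := hG.finite_cell 1
  have := hG.finite_cell 2
  let _ := Fintype.ofFinite Edge
  let _ := Fintype.ofFinite Face
  set N := {e : Edge | v.IsEnd e}.toFinset with hN
  set A := {h : Option Face | v.On h}.toFinset with hA
  have hNcard : N.card = 3 := by
    rw [hN, ← Set.ncard_eq_toFinset_card', ← hdeg, Vertex.degree]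
    congr 1
    ext e
    exact v.isEnd_iff_mem_cellFrontier e
  have hmN : ∀ e, e ∈ N ↔ v.IsEnd e := fun e => Set.mem_toFinset
  have hmA : ∀ h, h ∈ A ↔ v.On h := fun e => Set.mem_toFinset
  have hside : ∀ e ∈ N, ∃ g g', g ≠ g' ∧ A.filter e.On = {g, g'} := by
    intro e he
    obtain ⟨g, g', hne, h⟩ := e.exists_sides hG
    refine ⟨g, g', hne, ?_⟩
    ext k
    rw [Finset.mem_filter, hmA, Finset.mem_insert, Finset.mem_singleton, ← h k]
    exact ⟨fun hk => hk.2, fun hk => ⟨hk.vertex ((hmN e).1 he), hk⟩⟩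
  have hedge : ∀ g ∈ A, (N.filter fun e => e.On g).card = 2 := by
    intro g hg
    obtain ⟨e₁, e₂, hne, h⟩ := Vertex.exists_edges_on hG ((hmA g).1 hg)
    rw [← Finset.card_pair hne]
    congr 1
    ext e
    rw [Finset.mem_filter, hmN, Finset.mem_insert, Finset.mem_singleton, ← h e]
  -- Incidences are counted twice: each of the three edges has two sides, and each side at `v` has
  -- two edges.
  have hAcard : A.card = 3 := by
    have := Finset.card_mul_eq_card_mul (s := N) (t := A) (m := 2) (n := 2) Edge.On
      (fun e he => by
        obtain ⟨g, g', hne, h⟩ := hside e he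
        rw [Finset.bipartiteAbove, h, Finset.card_pair hne])
      (fun g hg => hedge g hg)
    omega
  let φ := (Fintype.equivFinOfCardEq (α := N) (by rw [Fintype.card_coe, hNcard])).symm
  let E : Fin 3 → Edge := fun i => φ i
  have hE : Function.Injective E := Subtype.val_injective.comp φ.injective
  have hEN : ∀ i, E i ∈ N := fun i => (φ i).2
  have hEs : ∀ e, v.IsEnd e ↔ ∃ i, E i = e := by
    intro e
    constructor
    · intro he
      exact ⟨φ.symm ⟨e, (hmN e).2 he⟩, by simp [E]⟩
    · rintro ⟨i, rfl⟩
      exact (hmN _).1 (hEN i)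
  have hex : ∀ i, ∃ g ∈ A, ¬ (E i).On g := by
    intro i
    by_contra hno
    push Not at hno
    obtain ⟨g, g', hne, h⟩ := hside (E i) (hEN i)
    rw [Finset.filter_true_of_mem hno] at h
    rw [h, Finset.card_pair hne] at hAcard
    omega
  choose g hgA hg using hex
  have hon : ∀ i j, (E i).On (g j) ↔ i ≠ j := by
    intro i j
    refine ⟨?_, fun hij => ?_⟩
    · rintro h rfl
      exact hg i h
    · by_contra hno
      -- If `g j` missed both `E i` and `E j`, at most one edge would be left for it.
      have hsub : (N.filter fun e => e.On (g j)) ⊆ (N.erase (E i)).erase (E j) := by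
        intro e he
        rw [Finset.mem_filter] at he
        rw [Finset.mem_erase, Finset.mem_erase]
        refine ⟨?_, ?_, he.1⟩
        · rintro rfl
          exact hg j he.2
        · rintro rfl
          exact hno he.2
      have := Finset.card_le_card hsub
      rw [hedge _ (hgA j), Finset.card_erase_of_mem (Finset.mem_erase.2
        ⟨fun h => hij (hE h.symm), hEN j⟩), Finset.card_erase_of_mem (hEN i), hNcard] at this
      omega
  have hginj : Function.Injective g := by
    intro i j hij
    by_contra hne
    exact hg j (hij ▸ (hon j i).2 (Ne.symm hne))
  have himage : Finset.univ.image g = A := by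
    refine Finset.eq_of_subset_of_card_le ?_ ?_
    · intro x hx
      obtain ⟨i, -, rfl⟩ := Finset.mem_image.1 hx
      exact hgA i
    · rw [Finset.card_image_of_injective _ hginj, hAcard]
      simp
  refine ⟨E, g, hE, hginj, hEs, fun h => ?_, hon⟩
  rw [← hmA, ← himage]
  simp

/-- The hypotheses of the theorem on the graph used for the local structure of colourings. -/
structure IsCubicEven : Prop where
  cellular : IsCellularDecomposition
  degree (v : Vertex) : v.degree = 3
  even (f : Face) : Even (length f.boundary)

namespace IsCubicEven

/-- At a vertex, there is at most one side off a given edge. -/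
theorem side_unique (hc : IsCubicEven) {v : Vertex} {e : Edge} (hve : v.IsEnd e) {a b : Option Face} (ha : v.On a)
    (hb : v.On b) (hea : ¬ e.On a) (heb : ¬ e.On b) : a = b := by
  obtain ⟨E, g, hE, hg, hEs, hgs, hon⟩ := v.exists_local hc.cellular (hc.degree v)
  obtain ⟨i, rfl⟩ := (hEs e).1 hve
  obtain ⟨j, rfl⟩ := (hgs a).1 ha
  obtain ⟨k, rfl⟩ := (hgs b).1 hb
  rw [hon, not_not] at hea heb
  rw [← hea, ← heb]

/-- Two edges at a vertex on a common side: every other side at the vertex is on exactly one of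
them. -/
theorem on_iff_not_on (hc : IsCubicEven) {v : Vertex} {e e' : Edge} (hve : v.IsEnd e)
    (hve' : v.IsEnd e')
    (hne : e ≠ e') {g a : Option Face} (he : e.On g) (he' : e'.On g) (ha : v.On a) (hag : a ≠ g) :
    e.On a ↔ ¬ e'.On a := by
  obtain ⟨E, G, hE, hG, hEs, hgs, hon⟩ := v.exists_local hc.cellular (hc.degree v)
  obtain ⟨i, rfl⟩ := (hEs e).1 hve
  obtain ⟨j, rfl⟩ := (hEs e').1 hve'
  obtain ⟨k, rfl⟩ := (hgs a).1 ha
  obtain ⟨l, rfl⟩ := (hgs g).1 (he.vertex hve)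
  have hij : i ≠ j := fun h => hne (h ▸ rfl)
  have hkl : k ≠ l := fun h => hag (h ▸ rfl)
  rw [hon] at he he'
  rw [hon, hon]
  -- The indices `i`, `j`, `l` exhaust `Fin 3`, so `k ≠ l` is `i` or `j`.
  omega

/-- An edge on a side `g` has at most one other side. -/
theorem other_unique (hc : IsCubicEven) {e : Edge} {g a b : Option Face} (hg : e.On g) (ha : e.On a) (hb : e.On b)
    (hag : a ≠ g) (hbg : b ≠ g) : a = b := by
  obtain ⟨s, t, -, h⟩ := e.exists_sides hc.cellular
  rcases (h g).1 hg with rfl | rfl <;> rcases (h a).1 ha with rfl | rfl <;>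
    rcases (h b).1 hb with rfl | rfl <;> first | rfl | contradiction

end IsCubicEven

end Sides

/-! ### Flat choices of sides along edges and around faces. -/

section Flat

variable [CWComplex (Set.univ : Set Cylinder)]

/-- A choice of a side at each vertex in `C` is flat if along each edge in `C` it is consistent with
the sides of that edge. -/
structure IsFlatOn (C : Set Cylinder) (m : Vertex → Option Face) : Prop where
  on (v : Vertex) : v.pos ∈ C → v.On (m v)
  -- Only the sides of `e` are required to persist. If `m u` is the third side at `u`, then `m v` is
  -- the third side at `v`, since a side of `e` would persist from `v` back to `u`.
  eq (e : Edge) : e.closed ⊆ C → ∀ u v : Vertex, u.IsEnd e → v.IsEnd e → ∀ g, e.On g →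
    m u = g → m v = g

theorem IsFlatOn.mono {C D : Set Cylinder} {m : Vertex → Option Face} (h : IsFlatOn D m)
    (hCD : C ⊆ D) : IsFlatOn C m :=
  ⟨fun v hv => h.on v (hCD hv), fun e he => h.eq e (he.trans hCD)⟩

/-- Flat choices that agree at one end of an edge agree at the other. -/
theorem IsFlatOn.eq_of_eq (hc : IsCubicEven) {C : Set Cylinder} {m m' : Vertex → Option Face}
    (h : IsFlatOn C m) (h' : IsFlatOn C m') {e : Edge} (he : e.closed ⊆ C) {u v : Vertex}
    (hu : u.IsEnd e) (hv : v.IsEnd e) (huv : m u = m' u) : m v = m' v := by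
  by_cases hon : e.On (m u)
  · rw [h.eq e he u v hu hv _ hon rfl, h'.eq e he u v hu hv _ hon huv.symm]
  · refine hc.side_unique hv (h.on v (he hv)) (h'.on v (he hv)) (fun hk => hon ?_)
      (fun hk => hon ?_)
    · rwa [h.eq e he v u hv hu _ hk rfl]
    · rwa [huv, h'.eq e he v u hv hu _ hk rfl]

/-- Flat choices on the boundary of a face are determined by their value at one vertex. -/
theorem IsFlatOn.eq_on_boundary (hc : IsCubicEven) {f : Face} {m m' : Vertex → Option Face}
    (h : IsFlatOn f.boundary m) (h' : IsFlatOn f.boundary m') {u v : Vertex}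
    (hu : u.pos ∈ f.boundary) (hv : v.pos ∈ f.boundary) (huv : m u = m' u) : m v = m' v :=
  (f.isCircuit_boundary hc.cellular).forall_of_exists hc.cellular (P := fun w => m w = m' w)
    (fun _ he _ _ hu hv => h.eq_of_eq hc h' he hu hv) hu huv hv

/-- Along a face of even length, every side at a vertex extends to a flat choice. -/
theorem exists_isFlatOn_boundary (hc : IsCubicEven) {f : Face} {u : Vertex}
    (hu : u.pos ∈ f.boundary) {a : Option Face} (ha : u.On a) :
    ∃ m, IsFlatOn f.boundary m ∧ m u = a := by
  by_cases haf : a = some f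
  · exact ⟨fun _ => some f, ⟨fun v hv => hv, fun _ _ _ _ _ _ _ _ h => h⟩, haf.symm⟩
  have hcirc := f.isCircuit_boundary hc.cellular
  -- At each vertex of `f` the choice is the side other than `f` of the boundary edge with the
  -- colour of `e₀`, an edge on `a`. Along an edge of that colour both ends get its far side; along
  -- an edge of the other colour neither end gets a side of the edge.
  obtain ⟨χ, hχ⟩ := hcirc.exists_coloring hc.cellular (hc.even f)
  obtain ⟨e₀, hue₀, he₀, hae₀⟩ : ∃ e : Edge, u.IsEnd e ∧ e.closed ⊆ f.boundary ∧ e.On a := by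
    obtain ⟨e₁, e₂, hne, h⟩ := hcirc.exists_edges hc.cellular hu
    obtain ⟨h1, h1'⟩ := (h e₁).2 (Or.inl rfl)
    obtain ⟨h2, h2'⟩ := (h e₂).2 (Or.inr rfl)
    have := hc.on_iff_not_on h1 h2 hne (g := some f) h1' h2' ha haf
    by_cases hon : e₂.On a
    · exact ⟨e₂, h2, h2', hon⟩
    · exact ⟨e₁, h1, h1', this.2 hon⟩
  have hunique : ∀ (v : Vertex) (e e' : Edge), v.IsEnd e → e.closed ⊆ f.boundary → v.IsEnd e' →
      e'.closed ⊆ f.boundary → (χ e ↔ χ e₀) → (χ e' ↔ χ e₀) → e = e' := by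
    intro v e e' h1 h2 h3 h4 h5 h6
    by_contra hne
    have := hχ v e e' h1 h2 h3 h4 hne
    tauto
  have hex : ∀ v : Vertex, ∃ g : Option Face, v.pos ∈ f.boundary → g ≠ some f ∧
      ∃ e : Edge, v.IsEnd e ∧ e.closed ⊆ f.boundary ∧ (χ e ↔ χ e₀) ∧ e.On g := by
    intro v
    by_cases hv : v.pos ∈ f.boundary
    · obtain ⟨e, h1, h2, h3⟩ : ∃ e : Edge, v.IsEnd e ∧ e.closed ⊆ f.boundary ∧ (χ e ↔ χ e₀) := by
        obtain ⟨e₁, e₂, hne, h⟩ := hcirc.exists_edges hc.cellular hv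
        obtain ⟨h1, h1'⟩ := (h e₁).2 (Or.inl rfl)
        obtain ⟨h2, h2'⟩ := (h e₂).2 (Or.inr rfl)
        have := hχ v e₁ e₂ h1 h1' h2 h2' hne
        by_cases hiff : χ e₁ ↔ χ e₀
        · exact ⟨e₁, h1, h1', hiff⟩
        · exact ⟨e₂, h2, h2', by tauto⟩
      obtain ⟨g, g', hne, h⟩ := e.exists_sides hc.cellular
      by_cases hg : g = some f
      · exact ⟨g', fun _ => ⟨fun h' => hne (hg.trans h'.symm), e, h1, h2, h3, (h g').2 (Or.inr rfl)⟩⟩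
      · exact ⟨g, fun _ => ⟨hg, e, h1, h2, h3, (h g).2 (Or.inl rfl)⟩⟩
    · exact ⟨none, fun h => absurd h hv⟩
  choose m hm using hex
  refine ⟨m, ⟨fun v hv => ?_, fun e he v w hv hw g heg hvg => ?_⟩, ?_⟩
  · obtain ⟨-, e, h1, -, -, h2⟩ := hm v hv
    exact h2.vertex h1
  · obtain ⟨hgf, e₁, h1, h2, h3, h4⟩ := hm v (he hv)
    obtain ⟨hgf', e₂, h1', h2', h3', h4'⟩ := hm w (he hw)
    rw [hvg] at h4 hgf
    have hee : e = e₁ := by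
      by_contra hne
      have := hc.on_iff_not_on hv h1 hne (g := some f) he h2 (heg.vertex hv) hgf
      tauto
    subst hee
    obtain rfl := hunique w e e₂ hw he h1' h2' h3 h3'
    exact hc.other_unique (g := some f) he h4' heg hgf' hgf
  · obtain ⟨hgf, e, h1, h2, h3, h4⟩ := hm u hu
    obtain rfl := hunique u e e₀ h1 h2 hue₀ he₀ h3 Iff.rfl
    exact hc.other_unique (g := some f) h2 h4 hae₀ hgf haf

/-! ### Carriers of points and flat choices on cells. -/

/-- `K` is the closed cell whose open cell contains `x`. -/
def IsCarrier (x : Cylinder) (K : Set Cylinder) : Prop :=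
  (∃ v : Vertex, v.pos = x ∧ K = {x}) ∨ (∃ e : Edge, x ∈ e.inner ∧ K = e.closed) ∨
    ∃ f : Face, x ∈ f.inner ∧ K = f.closed

theorem IsCellularDecomposition.exists_isCarrier (hG : IsCellularDecomposition) (x : Cylinder) :
    ∃ K, IsCarrier x K := by
  rcases hG.mem_graph_or x with (⟨v, hv⟩ | ⟨e, he⟩) | ⟨f, hf⟩
  · exact ⟨_, Or.inl ⟨v, hv, rfl⟩⟩
  · exact ⟨_, Or.inr (Or.inl ⟨e, he, rfl⟩)⟩
  · exact ⟨_, Or.inr (Or.inr ⟨f, hf, rfl⟩)⟩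

theorem IsCarrier.mem {x : Cylinder} {K : Set Cylinder} (h : IsCarrier x K) : x ∈ K := by
  rcases h with ⟨v, hv, rfl⟩ | ⟨e, he, rfl⟩ | ⟨f, hf, rfl⟩
  · rfl
  · exact e.inner_subset_closed he
  · exact f.inner_subset_closed hf

theorem IsCarrier.subset_edge {x : Cylinder} {K : Set Cylinder} (h : IsCarrier x K) {e : Edge}
    (he : x ∈ e.closed) : K ⊆ e.closed := by
  rcases h with ⟨v, hv, rfl⟩ | ⟨e', he', rfl⟩ | ⟨f, hf, rfl⟩
  · exact Set.singleton_subset_iff.2 he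
  · rw [Edge.eq_of_mem_inner_of_mem_closed he' he]
  · exact absurd hf (Set.disjoint_left.1 (e.closed_disjoint_inner f) he)

theorem IsCarrier.subset_face (hG : IsCellularDecomposition) {x : Cylinder} {K : Set Cylinder}
    (h : IsCarrier x K) {f : Face} (hf : x ∈ f.closed) : K ⊆ f.closed := by
  rcases h with ⟨v, hv, rfl⟩ | ⟨e', he', rfl⟩ | ⟨f', hf', rfl⟩
  · exact Set.singleton_subset_iff.2 hf
  · exact ((Edge.closed_subset_boundary_iff f hG he').2 hf).trans f.boundary_subset_closed
  · rw [f.closed_eq] at hf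
    rcases hf with h | h
    · exact absurd hf' (Set.disjoint_left.1 (f.boundary_disjoint_inner f') h)
    · rw [Face.eq_of_mem_inner hf' h]

theorem IsCarrier.subset (hG : IsCellularDecomposition) {x y : Cylinder} {K L : Set Cylinder}
    (hx : IsCarrier x K) (hy : IsCarrier y L) (hxL : x ∈ L) : K ⊆ L := by
  rcases hy with ⟨v, hv, rfl⟩ | ⟨e, he, rfl⟩ | ⟨f, hf, rfl⟩
  · obtain rfl : x = y := hxL
    rcases hx with ⟨v', hv', rfl⟩ | ⟨e', he', rfl⟩ | ⟨f', hf', rfl⟩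
    · exact le_rfl
    · exact absurd (hv ▸ he') (v.pos_notMem_edge_inner e')
    · exact absurd (hv ▸ hf') (v.pos_notMem_face_inner f')
  · exact hx.subset_edge hxL
  · exact hx.subset_face hG hxL

/-- The carrier of a point is the closed cell whose open cell contains it. -/
noncomputable def carrier (x : Cylinder) : Set Cylinder := Classical.epsilon (IsCarrier x)

theorem isCarrier_carrier (hG : IsCellularDecomposition) (x : Cylinder) :
    IsCarrier x (carrier x) :=
  Classical.epsilon_spec (hG.exists_isCarrier x)

theorem carrier_eq (hG : IsCellularDecomposition) {x : Cylinder} {K : Set Cylinder}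
    (hK : IsCarrier x K) : carrier x = K :=
  ((isCarrier_carrier hG x).subset hG hK hK.mem).antisymm
    (hK.subset hG (isCarrier_carrier hG x) (isCarrier_carrier hG x).mem)

/-- Closed cells are finite in number, so those near `x` all contain `x`. This semicontinuity makes
open stars open and transport locally constant. -/
theorem eventually_carrier_subset (hG : IsCellularDecomposition) (x : Cylinder) :
    ∀ᶠ y in 𝓝 x, carrier x ⊆ carrier y := by
  filter_upwards [hG.eventually_mem x] with y hy
  refine (isCarrier_carrier hG x).subset hG (isCarrier_carrier hG y) ?_
  rcases isCarrier_carrier hG y with ⟨v, hv, h⟩ | ⟨e, he, h⟩ | ⟨f, hf, h⟩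
  · rw [h, ← hv]
    exact (hy.1 v hv).symm
  · rw [h]
    exact hy.2.1 e (e.inner_subset_closed he)
  · rw [h]
    exact hy.2.2 f (f.inner_subset_closed hf)

theorem Vertex.pos_mem_boundary {v : Vertex} {f : Face} (h : v.pos ∈ f.closed) :
    v.pos ∈ f.boundary := by
  rw [f.closed_eq] at h
  exact h.resolve_right (v.pos_notMem_face_inner f)

theorem Edge.closed_subset_boundary {e : Edge} {f : Face} (h : e.closed ⊆ f.closed) :
    e.closed ⊆ f.boundary := by
  intro x hx
  have := h hx
  rw [f.closed_eq] at this
  exact this.resolve_right (Set.disjoint_left.1 (e.closed_disjoint_inner f) hx)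

theorem IsFlatOn.of_boundary {f : Face} {m : Vertex → Option Face} (h : IsFlatOn f.boundary m) :
    IsFlatOn f.closed m :=
  ⟨fun v hv => h.on v (Vertex.pos_mem_boundary hv),
    fun e he => h.eq e (Edge.closed_subset_boundary he)⟩

theorem Vertex.exists_isEnd (v : Vertex) (hc : IsCubicEven) : ∃ e : Edge, v.IsEnd e := by
  obtain ⟨E, -, -, -, h, -⟩ := v.exists_local hc.cellular (hc.degree v)
  exact ⟨E 0, (h _).2 ⟨0, rfl⟩⟩

/-- Every point lies in a closed face. -/
theorem exists_mem_face (hc : IsCubicEven) (x : Cylinder) : ∃ f : Face, x ∈ f.closed := by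
  rcases hc.cellular.mem_graph_or x with (⟨v, rfl⟩ | ⟨e, he⟩) | ⟨f, hf⟩
  · obtain ⟨e, he⟩ := v.exists_isEnd hc
    obtain ⟨f, hf⟩ := e.exists_face hc.cellular
    exact ⟨f, f.boundary_subset_closed (hf he)⟩
  · obtain ⟨f, hf⟩ := e.exists_face hc.cellular
    exact ⟨f, f.boundary_subset_closed (hf (e.inner_subset_closed he))⟩
  · exact ⟨f, f.inner_subset_closed hf⟩

/-- On a closed cell, every side at a vertex extends to a flat choice. -/
theorem exists_isFlatOn_carrier (hc : IsCubicEven) (x : Cylinder) {u : Vertex}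
    (hu : u.pos ∈ carrier x) {a : Option Face} (ha : u.On a) :
    ∃ m, IsFlatOn (carrier x) m ∧ m u = a := by
  obtain ⟨f, hf⟩ := exists_mem_face hc x
  have hsub := (isCarrier_carrier hc.cellular x).subset_face hc.cellular hf
  obtain ⟨m, hm, hmu⟩ := exists_isFlatOn_boundary hc (Vertex.pos_mem_boundary (hsub hu)) ha
  exact ⟨m, hm.of_boundary.mono hsub, hmu⟩

/-- On a closed cell, flat choices are determined by their value at one vertex. -/
theorem IsFlatOn.eq_on_carrier (hc : IsCubicEven) {x : Cylinder} {m m' : Vertex → Option Face}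
    (h : IsFlatOn (carrier x) m) (h' : IsFlatOn (carrier x) m') {u v : Vertex}
    (hu : u.pos ∈ carrier x) (hv : v.pos ∈ carrier x) (huv : m u = m' u) : m v = m' v := by
  rcases isCarrier_carrier hc.cellular x with ⟨w, hw, hK⟩ | ⟨e, he, hK⟩ | ⟨f, hf, hK⟩
  · rw [hK] at hu hv
    rwa [← Vertex.pos_injective ((show u.pos = x from hu).trans (show v.pos = x from hv).symm)]
  · rw [hK] at h h' hu hv
    exact h.eq_of_eq hc h' le_rfl hu hv huv
  · rw [hK] at h h' hu hv
    exact (h.mono f.boundary_subset_closed).eq_on_boundary hc (h'.mono f.boundary_subset_closed)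
      (Vertex.pos_mem_boundary hu) (Vertex.pos_mem_boundary hv) huv

theorem exists_vertex_mem_carrier (hc : IsCubicEven) (x : Cylinder) :
    ∃ v : Vertex, v.pos ∈ carrier x := by
  rcases isCarrier_carrier hc.cellular x with ⟨w, hw, hK⟩ | ⟨e, he, hK⟩ | ⟨f, hf, hK⟩
  · exact ⟨w, by rw [hK]; exact hw⟩
  · obtain ⟨u, _, -, h⟩ := e.exists_isEnd_iff hc.cellular
    exact ⟨u, by rw [hK]; exact (h u).2 (Or.inl rfl)⟩
  · obtain ⟨v, hv⟩ := (f.isCircuit_boundary hc.cellular).exists_vertex hc.cellular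
    exact ⟨v, by rw [hK]; exact f.boundary_subset_closed hv⟩

/-- Global flat choices are determined by their value at one vertex. -/
theorem IsFlatOn.eq_of_univ (hc : IsCubicEven) {m m' : Vertex → Option Face}
    (h : IsFlatOn Set.univ m) (h' : IsFlatOn Set.univ m') {u : Vertex} (hu : m u = m' u) :
    m = m' := by
  have := hc.cellular.finite_cell 2
  -- On each face, `m` and `m'` agree at all vertices or at none. The faces of the two kinds form
  -- closed sets covering the connected cylinder; at a common point, a vertex of its carrier would
  -- be of both kinds.
  let A (Q : Prop → Prop) : Set Cylinder :=
    ⋃ f ∈ {f : Face | ∀ v : Vertex, v.pos ∈ f.boundary → Q (m v = m' v)}, f.closed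
  have hA : ∀ Q, IsClosed (A Q) := fun Q =>
    (Set.toFinite _).isClosed_biUnion fun f _ => f.isClosed
  have hcases : ∀ (f : Face), (∀ v : Vertex, v.pos ∈ f.boundary → m v = m' v) ∨
      ∀ v : Vertex, v.pos ∈ f.boundary → ¬ m v = m' v := by
    intro f
    by_contra hno
    push Not at hno
    obtain ⟨⟨v, hv, hne⟩, w, hw, heq⟩ := hno
    exact hne ((h.mono (Set.subset_univ _)).eq_on_boundary hc (h'.mono (Set.subset_univ _)) hw hv
      heq)
  have hcover : Set.univ ⊆ A id ∪ A Not := by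
    intro x _
    obtain ⟨f, hf⟩ := exists_mem_face hc x
    rcases hcases f with h | h
    · exact Or.inl (Set.mem_biUnion (show f ∈ {f : Face | _} from h) hf)
    · exact Or.inr (Set.mem_biUnion (show f ∈ {f : Face | _} from h) hf)
  have hmem : ∀ x Q, x ∈ A Q → ∀ v : Vertex, v.pos ∈ carrier x → Q (m v = m' v) := by
    intro x Q hx v hv
    simp only [A, Set.mem_iUnion] at hx
    obtain ⟨f, hf, hxf⟩ := hx
    exact hf v (Vertex.pos_mem_boundary
      ((isCarrier_carrier hc.cellular x).subset_face hc.cellular hxf hv))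
  funext v
  by_contra hne
  have hself : ∀ v : Vertex, v.pos ∈ carrier v.pos := fun v =>
    (isCarrier_carrier hc.cellular v.pos).mem
  obtain ⟨x, -, hx1, hx2⟩ := isPreconnected_closed_iff.1 isPreconnected_univ _ _ (hA id) (hA Not)
    hcover
    ⟨u.pos, trivial, (hcover trivial).resolve_right fun hx => hmem _ _ hx u (hself u) hu⟩
    ⟨v.pos, trivial, (hcover trivial).resolve_left fun hx => hne (hmem _ _ hx v (hself v))⟩
  obtain ⟨w, hw⟩ := exists_vertex_mem_carrier hc x
  exact hmem x Not hx2 w hw (hmem x id hx1 w hw)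

/-- On a boundary circle of odd length, a global flat choice takes the outside everywhere. -/
theorem IsFlatOn.eq_none (hc : IsCubicEven) {m : Vertex → Option Face}
    (h : IsFlatOn Set.univ m) {t : unitInterval} (ht : t = 0 ∨ t = 1)
    (hodd : Odd (length (circleAt t))) {v : Vertex} (hv : v.pos ∈ circleAt t) : m v = none := by
  by_contra hne
  have hsub := circleAt_subset_rim ht
  have hcirc := isCircuit_circleAt hc.cellular hsub
  have hnone : ∀ e : Edge, e.closed ⊆ circleAt t → e.On none := fun e he => he.trans hsub
  -- The outside is a side of every edge of the circle, so the value `none` at one vertex would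
  -- propagate to all.
  have hall : ∀ w : Vertex, w.pos ∈ circleAt t → m w ≠ none := fun w hw =>
    hcirc.forall_of_exists hc.cellular (P := fun w => m w ≠ none)
      (fun e he u w hu hw hmu hmw =>
        hmu (h.eq e (Set.subset_univ _) w u hw hu none (hnone e he) hmw)) hv hne hw
  -- A side other than the outside lies on exactly one of the two circle edges at its vertex; these
  -- edges form a perfect matching of the circle.
  refine Nat.not_even_iff_odd.2 hodd (hcirc.even_length hc.cellular
    (fun v e => v.IsEnd e ∧ e.On (m v)) (fun v e he => he.1) (fun v hv => ?_)
    fun e he u w hu hw hR => ⟨hw, ?_⟩)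
  · obtain ⟨e₁, e₂, hne, hiff⟩ := hcirc.exists_edges hc.cellular hv
    obtain ⟨h1, h1'⟩ := (hiff e₁).2 (Or.inl rfl)
    obtain ⟨h2, h2'⟩ := (hiff e₂).2 (Or.inr rfl)
    have hx := hc.on_iff_not_on h1 h2 hne (hnone _ h1') (hnone _ h2') (h.on v trivial) (hall v hv)
    by_cases hon : e₁.On (m v)
    · refine ⟨e₁, ⟨⟨h1, hon⟩, h1'⟩, ?_⟩
      rintro e ⟨⟨ha, hb⟩, hc'⟩
      rcases (hiff e).1 ⟨ha, hc'⟩ with rfl | rfl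
      · rfl
      · exact absurd hb (hx.1 hon)
    · refine ⟨e₂, ⟨⟨h2, by tauto⟩, h2'⟩, ?_⟩
      rintro e ⟨⟨ha, hb⟩, hc'⟩
      rcases (hiff e).1 ⟨ha, hc'⟩ with rfl | rfl
      · exact absurd hb hon
      · rfl
  · rw [h.eq e (Set.subset_univ _) u w hu hw _ hR.2 rfl]
    exact hR.2

end Flat

/-! ### The three-sheeted covering of sides and its sections. -/

/-- The universal covering of the cylinder by a strip. -/
noncomputable def fromStrip (y : ℝ × unitInterval) : Cylinder := (Circle.exp y.1, y.2)

theorem isQuotientMap_fromStrip : IsQuotientMap fromStrip := by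
  have h1 : IsOpenQuotientMap Circle.exp :=
    ⟨Circle.exp_surjective, Circle.exp.continuous, isLocalHomeomorph_circleExp.isOpenMap⟩
  exact (h1.prodMap (IsOpenQuotientMap.id (X := unitInterval))).isQuotientMap

/-- A covering of the cylinder with a section over one boundary circle has a global section. -/
theorem exists_section_of_isCoveringMap {E : Type*} [TopologicalSpace E] {p : E → Cylinder}
    (hp : IsCoveringMap p) {s₀ : Circle → E} (hs₀ : Continuous s₀) (hps₀ : ∀ z, p (s₀ z) = (z, 0)) :
    ∃ s : Cylinder → E, Continuous s ∧ ∀ x, p (s x) = x := by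
  -- Clamping the height extends the universal covering to the whole plane, a convenient simply
  -- connected domain for the lift.
  let q : C(ℝ × ℝ, Cylinder) :=
    ⟨fun y => (Circle.exp y.1, Set.projIcc 0 1 zero_le_one y.2), by fun_prop⟩
  obtain ⟨F, ⟨hF0, hF⟩, -⟩ := hp.existsUnique_continuousMap_lifts q (0, 0) (s₀ 1)
    (by rw [hps₀]; simp [q])
  let G : ℝ × unitInterval → E := fun y => F (y.1, y.2)
  have hG : Continuous G := by fun_prop
  have hpG : ∀ y, p (G y) = fromStrip y := by
    intro y
    have := congrFun hF (y.1, (y.2 : ℝ))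
    simpa [q, fromStrip] using this
  -- Both sides lift the same path and agree at `0`. Thus the lift closes up over the lower boundary
  -- circle.
  have hrim : (fun θ : ℝ => G (θ, 0)) = fun θ => s₀ (Circle.exp θ) := by
    refine hp.eq_of_comp_eq (by fun_prop) (by fun_prop) ?_ 0 ?_
    · funext θ
      simp only [Function.comp_apply, hpG, hps₀, fromStrip]
    · simpa [G] using hF0
  -- The translate by `2π` is another lift of the same map, and agreement at one point of the lower
  -- boundary forces equality; so the lift descends to the cylinder.
  have hper : (fun y : ℝ × unitInterval => G (y.1 + 2 * Real.pi, y.2)) = G := by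
    refine hp.eq_of_comp_eq (by fun_prop) hG ?_ (0, 0) ?_
    · funext y
      simp only [Function.comp_apply, hpG, fromStrip, Circle.exp_add_two_pi]
    · have h1 := congrFun hrim (0 + 2 * Real.pi)
      have h2 := congrFun hrim 0
      simp only [Circle.exp_add_two_pi] at h1
      exact h1.trans h2.symm
  have hinv : ∀ y z, fromStrip y = fromStrip z → G y = G z := by
    rintro ⟨θ, t⟩ ⟨θ', t'⟩ h
    obtain rfl : t = t' := congrArg Prod.snd h
    obtain ⟨m, rfl⟩ := Circle.exp_eq_exp.1 (congrArg Prod.fst h)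
    have : Function.Periodic (fun θ => G (θ, t)) (2 * Real.pi) := fun θ => congrFun hper (θ, t)
    exact this.int_mul m θ'
  let r := Function.surjInv isQuotientMap_fromStrip.surjective
  have hr : ∀ x, fromStrip (r x) = x := Function.surjInv_eq _
  refine ⟨fun x => G (r x), ?_, fun x => (hpG _).trans (hr x)⟩
  rw [isQuotientMap_fromStrip.continuous_iff]
  exact hG.congr fun y => hinv _ _ (hr _).symm

section Bundle

variable [CWComplex (Set.univ : Set Cylinder)]

/-- The sides at a vertex, in some order. -/
theorem Vertex.exists_label (v : Vertex) (hc : IsCubicEven) :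
    ∃ g : Fin 3 → Option Face, Function.Injective g ∧ ∀ h, v.On h ↔ ∃ i, g i = h := by
  obtain ⟨-, g, -, hg, -, h, -⟩ := v.exists_local hc.cellular (hc.degree v)
  exact ⟨g, hg, h⟩

namespace IsCubicEven

/-- An enumeration of the three sides at a vertex. -/
noncomputable def label (hc : IsCubicEven) (v : Vertex) : Fin 3 → Option Face :=
  Classical.choose (v.exists_label hc)

theorem label_injective (hc : IsCubicEven) (v : Vertex) : Function.Injective (hc.label v) :=
  (Classical.choose_spec (v.exists_label hc)).1

theorem on_iff_label (hc : IsCubicEven) (v : Vertex) (h : Option Face) :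
    v.On h ↔ ∃ i, hc.label v i = h :=
  (Classical.choose_spec (v.exists_label hc)).2 h

/-- Some flat choice on the cell of `x` takes the `i`-th side at `u` and the `j`-th side at `v`. -/
def Rel (hc : IsCubicEven) (u v : Vertex) (x : Cylinder) (i j : Fin 3) : Prop :=
  ∃ m, IsFlatOn (carrier x) m ∧ m u = hc.label u i ∧ m v = hc.label v j

/-- The transport of sides from `u` to `v` through the cell of `x`. -/
noncomputable def transport (hc : IsCubicEven) (u v : Vertex) (x : Cylinder) (i : Fin 3) : Fin 3 :=
  Classical.epsilon (hc.Rel u v x i)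

/-- The open star of a vertex. -/
def star (u : Vertex) : Set Cylinder := {x | u.pos ∈ carrier x}

theorem rel_transport (hc : IsCubicEven) {u v : Vertex} {x : Cylinder} (hu : x ∈ star u)
    (hv : x ∈ star v) (i : Fin 3) : hc.Rel u v x i (hc.transport u v x i) := by
  refine Classical.epsilon_spec (p := hc.Rel u v x i) ?_
  obtain ⟨m, hm, hmu⟩ := exists_isFlatOn_carrier hc x hu ((hc.on_iff_label u _).2 ⟨i, rfl⟩)
  obtain ⟨j, hj⟩ := (hc.on_iff_label v _).1 (hm.on v hv)
  exact ⟨j, m, hm, hmu, hj.symm⟩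

theorem transport_eq (hc : IsCubicEven) {u v : Vertex} {x : Cylinder} (hu : x ∈ star u)
    (hv : x ∈ star v) {i j : Fin 3} (h : hc.Rel u v x i j) : hc.transport u v x i = j := by
  obtain ⟨m, hm, hmu, hmv⟩ := h
  obtain ⟨m', hm', hmu', hmv'⟩ := hc.rel_transport hu hv i
  have := hm.eq_on_carrier hc hm' hu hv (hmu.trans hmu'.symm)
  rw [hmv, hmv'] at this
  exact (hc.label_injective v this).symm

theorem isOpen_star (hc : IsCubicEven) (u : Vertex) : IsOpen (star u) := by
  rw [isOpen_iff_mem_nhds]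
  intro x hx
  filter_upwards [eventually_carrier_subset hc.cellular x] with y hy
  exact hy hx

/-- The three-sheeted covering of the cylinder whose points are the sides at the vertices of a cell,
up to flat transport. -/
noncomputable def bundle (hc : IsCubicEven) : FiberBundleCore Vertex Cylinder (Fin 3) where
  baseSet := star
  isOpen_baseSet := hc.isOpen_star
  indexAt x := Classical.choose (exists_vertex_mem_carrier hc x)
  mem_baseSet_at x := Classical.choose_spec (exists_vertex_mem_carrier hc x)
  coordChange := hc.transport
  coordChange_self u x hx i := by
    obtain ⟨m, hm, hmu⟩ := exists_isFlatOn_carrier hc x hx ((hc.on_iff_label u _).2 ⟨i, rfl⟩)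
    exact hc.transport_eq hx hx ⟨m, hm, hmu, hmu⟩
  continuousOn_coordChange u v := by
    rintro ⟨x, i⟩ ⟨⟨hu, hv⟩, -⟩
    refine ContinuousAt.continuousWithinAt ?_
    refine (tendsto_const_nhds.congr' ?_ : Filter.Tendsto _ _ (𝓝 (hc.transport u v x i)))
    rw [nhds_prod_eq, nhds_discrete (Fin 3), Filter.EventuallyEq]
    -- The carrier of a nearby `y` contains that of `x`, so a flat choice on the former restricts to
    -- one on the latter and realises the same transport.
    have h1 : ∀ᶠ y in 𝓝 x, hc.transport u v x i = hc.transport u v y i := by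
      filter_upwards [eventually_carrier_subset hc.cellular x] with y hy
      obtain ⟨m, hm, hmu, hmv⟩ := hc.rel_transport (hy hu) (hy hv) i
      exact hc.transport_eq hu hv ⟨m, hm.mono hy, hmu, hmv⟩
    rw [Filter.prod_pure, Filter.eventually_map]
    exact h1
  coordChange_comp u v w x hx i := by
    obtain ⟨⟨hu, hv⟩, hw⟩ := hx
    obtain ⟨m, hm, hmu⟩ := exists_isFlatOn_carrier hc x hu ((hc.on_iff_label u _).2 ⟨i, rfl⟩)
    obtain ⟨j, hj⟩ := (hc.on_iff_label v _).1 (hm.on v hv)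
    obtain ⟨k, hk⟩ := (hc.on_iff_label w _).1 (hm.on w hw)
    rw [hc.transport_eq hu hv ⟨m, hm, hmu, hj.symm⟩, hc.transport_eq hv hw ⟨m, hm, hj.symm, hk.symm⟩,
      hc.transport_eq hu hw ⟨m, hm, hmu, hk.symm⟩]

theorem isCoveringMap_proj (hc : IsCubicEven) : IsCoveringMap hc.bundle.proj :=
  FiberBundle.isCoveringMap (F := Fin 3) (E := hc.bundle.Fiber)

/-- The side at `u` belonging to a point of the covering. -/
noncomputable def sideAt (hc : IsCubicEven) (u : Vertex) (p : hc.bundle.TotalSpace) : Option Face :=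
  hc.label u (hc.transport (hc.bundle.indexAt p.1) u p.1 p.2)

/-- A point of the covering defines a flat choice on its cell. -/
theorem exists_isFlatOn_sideAt (hc : IsCubicEven) (p : hc.bundle.TotalSpace) :
    ∃ m, IsFlatOn (carrier p.1) m ∧ ∀ u : Vertex, u.pos ∈ carrier p.1 → hc.sideAt u p = m u := by
  have h0 : p.1 ∈ star (hc.bundle.indexAt p.1) := hc.bundle.mem_baseSet_at p.1
  obtain ⟨m, hm, hmu⟩ := exists_isFlatOn_carrier hc p.1 h0
    ((hc.on_iff_label (hc.bundle.indexAt p.1) _).2 ⟨p.2, rfl⟩)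
  refine ⟨m, hm, fun u hu => ?_⟩
  obtain ⟨j, hj⟩ := (hc.on_iff_label u _).1 (hm.on u hu)
  rw [sideAt, hc.transport_eq h0 hu ⟨m, hm, hmu, hj.symm⟩, hj]

/-- A continuous section of the covering takes constant sides on connected parts of open stars. -/
theorem sideAt_eq (hc : IsCubicEven) {s : Cylinder → hc.bundle.TotalSpace} (hs : Continuous s)
    (hps : ∀ x, (s x).1 = x) {u : Vertex} {S : Set Cylinder} (hS : IsPreconnected S)
    (hSu : S ⊆ star u) {x y : Cylinder} (hx : x ∈ S) (hy : y ∈ S) :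
    hc.sideAt u (s x) = hc.sideAt u (s y) := by
  have hcont : ContinuousOn (fun x => (hc.bundle.localTriv u (s x)).2) S := by
    refine continuous_snd.comp_continuousOn ?_
    refine (hc.bundle.localTriv u).continuousOn.comp hs.continuousOn fun x hx => ?_
    rw [FiberBundleCore.mem_localTriv_source, hps]
    exact hSu hx
  have := hS.constant hcont hx hy
  simp only [FiberBundleCore.localTriv_apply] at this
  exact congrArg (hc.label u) this

/-- A continuous section of the covering is a global flat choice. -/
theorem isFlatOn_of_section (hc : IsCubicEven) {s : Cylinder → hc.bundle.TotalSpace}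
    (hs : Continuous s) (hps : ∀ x, (s x).1 = x) :
    IsFlatOn Set.univ fun v => hc.sideAt v (s v.pos) := by
  refine ⟨fun v _ => (hc.on_iff_label v _).2 ⟨_, rfl⟩, fun e _ u v hu hv g hg hug => ?_⟩
  obtain ⟨x, hx⟩ := e.inner_nonempty
  have hK : carrier x = e.closed := carrier_eq hc.cellular (Or.inr (Or.inl ⟨e, hx, rfl⟩))
  -- The open edge together with its end `w` is connected and lies in the star of `w`, so the side
  -- at `w` can be read off at the interior point `x`. There both ends are governed by a single flat
  -- choice on the edge.
  have key : ∀ w : Vertex, w.IsEnd e → hc.sideAt w (s x) = hc.sideAt w (s w.pos) := by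
    intro w hw
    refine hc.sideAt_eq hs hps (u := w) (S := insert w.pos e.inner) ?_ ?_
      (Set.mem_insert_of_mem _ hx) (Set.mem_insert _ _)
    · refine e.isConnected_inner.subset_closure (Set.subset_insert _ _) ?_
      rw [e.closure_inner]
      exact Set.insert_subset hw e.inner_subset_closed
    · refine Set.insert_subset ?_ fun y hy => ?_
      · exact (isCarrier_carrier hc.cellular w.pos).mem
      · change w.pos ∈ carrier y
        rw [carrier_eq hc.cellular (Or.inr (Or.inl ⟨e, hy, rfl⟩))]
        exact hw
  obtain ⟨m, hm, hmeq⟩ := hc.exists_isFlatOn_sideAt (s x)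
  rw [hps, hK] at hm hmeq
  rw [← key u hu, hmeq u hu] at hug
  rw [← key v hv, hmeq v hv]
  exact hm.eq e le_rfl u v hu hv g hg hug

/-- The point over `x` of the covering that a choice of sides defines. -/
noncomputable def point (hc : IsCubicEven) (m : Vertex → Option Face) (x : Cylinder) :
    hc.bundle.TotalSpace :=
  ⟨x, show Fin 3 from
    Function.invFun (hc.label (hc.bundle.indexAt x)) (m (hc.bundle.indexAt x))⟩

theorem sideAt_point (hc : IsCubicEven) {m : Vertex → Option Face} {x : Cylinder}
    (hm : IsFlatOn (carrier x) m) {u : Vertex} (hu : u.pos ∈ carrier x) :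
    hc.sideAt u (hc.point m x) = m u := by
  have h0 : x ∈ star (hc.bundle.indexAt x) := hc.bundle.mem_baseSet_at x
  have h1 : hc.label (hc.bundle.indexAt x) (hc.point m x).2 = m (hc.bundle.indexAt x) :=
    Function.invFun_eq ((hc.on_iff_label _ _).1 (hm.on _ h0))
  obtain ⟨j, hj⟩ := (hc.on_iff_label u _).1 (hm.on u hu)
  rw [sideAt, ← hj]
  exact congrArg _ (hc.transport_eq h0 hu ⟨m, hm, h1.symm, hj.symm⟩)

/-- A choice of sides defines a continuous section of the covering where it is flat. -/
theorem continuousOn_point (hc : IsCubicEven) (m : Vertex → Option Face) :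
    ContinuousOn (hc.point m) {x | IsFlatOn (carrier x) m} := by
  intro x hx
  refine (FiberBundle.continuousWithinAt_totalSpace (Fin 3) (E := hc.bundle.Fiber)
    (hc.point m)).2 ⟨continuousWithinAt_id, ?_⟩
  set u := hc.bundle.indexAt x
  have hxu : x ∈ star u := hc.bundle.mem_baseSet_at x
  have key : ∀ y, IsFlatOn (carrier y) m → y ∈ star u →
      hc.label u (hc.bundle.localTriv u (hc.point m y)).2 = m u := fun y hy hyu =>
    hc.sideAt_point hy hyu
  refine (tendsto_const_nhds.congr' ?_ :
    Filter.Tendsto (fun y => (hc.bundle.localTriv u (hc.point m y)).2) _ _)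
  filter_upwards [self_mem_nhdsWithin,
    mem_nhdsWithin_of_mem_nhds ((hc.isOpen_star u).mem_nhds hxu)] with y hy hyu
  exact hc.label_injective u ((key x hx hxu).trans (key y hy hyu).symm)

theorem carrier_subset_circleAt (hc : IsCubicEven) {t : unitInterval} (ht : t = 0 ∨ t = 1)
    {x : Cylinder} (hx : x ∈ circleAt t) : carrier x ⊆ circleAt t := by
  have hsub := circleAt_subset_rim ht
  rcases isCarrier_carrier hc.cellular x with ⟨v, hv, h⟩ | ⟨e, he, h⟩ | ⟨f, hf, h⟩
  · rw [h]
    exact Set.singleton_subset_iff.2 hx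
  · rw [h]
    exact (isCircuit_circleAt hc.cellular hsub).closed_subset hc.cellular hx he
  · exact absurd (hsub hx) (f.inner_mem_nhds hc.cellular hf).2

/-- There is a global flat choice of sides. -/
theorem exists_isFlatOn_univ (hc : IsCubicEven) : ∃ m, IsFlatOn Set.univ m := by
  -- The outside is flat along the lower circle: this is the section from which the lift starts.
  have hflat : ∀ z : Circle, IsFlatOn (carrier (z, (0 : unitInterval))) fun _ => none := by
    intro z
    refine ⟨fun v hv => ?_, fun _ _ _ _ _ _ _ _ h => h⟩
    exact circleAt_subset_rim (Or.inl rfl) (hc.carrier_subset_circleAt (Or.inl rfl)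
      (show ((z, (0 : unitInterval)) : Cylinder) ∈ circleAt 0 from rfl) hv)
  obtain ⟨s, hs, hps⟩ := exists_section_of_isCoveringMap hc.isCoveringMap_proj
    (s₀ := fun z => hc.point (fun _ => none) (z, 0))
    ((hc.continuousOn_point _).comp_continuous (by fun_prop) hflat) fun _ => rfl
  exact ⟨_, hc.isFlatOn_of_section hs hps⟩

end IsCubicEven

end Bundle

/-! ### Flat choices and partitions of the faces. -/

section Partition

variable [CWComplex (Set.univ : Set Cylinder)]

/-- A global flat choice takes the value `f` at one vertex of `f` only if it does at all. -/
theorem IsFlatOn.eq_some_of_mem {m : Vertex → Option Face} (hc : IsCubicEven)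
    (h : IsFlatOn Set.univ m) {f : Face} {v w : Vertex} (hv : m v = some f)
    (hw : w.pos ∈ f.boundary) : m w = some f := by
  have hvf : v.On (some f) := hv ▸ h.on v trivial
  exact (f.isCircuit_boundary hc.cellular).forall_of_exists hc.cellular
    (P := fun v => m v = some f)
    (fun e he u v hu hv hmu => h.eq e (Set.subset_univ _) u v hu hv (some f) he hmu) hvf hv hw

/-- The sides at a vertex outside a set `F₁` of faces that has exactly two faces at the vertex. -/
theorem Vertex.existsUnique_side (v : Vertex) (hc : IsCubicEven) {F₀ F₁ : Set Face}
    (hdisj : Disjoint F₀ F₁) (hunion : F₀ ∪ F₁ = Set.univ)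
    (h2 : {f ∈ F₁ | f.AdjacentTo v}.ncard = 2) :
    ∃! g : Option Face, v.On g ∧ ∀ f, g = some f → f ∈ F₀ := by
  obtain ⟨g, hg, hon⟩ := v.exists_label hc
  have himage : (some '' {f ∈ F₁ | f.AdjacentTo v} : Set (Option Face)) =
      g '' {i | ∃ f ∈ F₁, g i = some f} := by
    ext h
    constructor
    · rintro ⟨f, ⟨hf, hfv⟩, rfl⟩
      obtain ⟨i, hi⟩ := (hon (some f)).1 hfv
      exact ⟨i, ⟨f, hf, hi⟩, hi⟩
    · rintro ⟨i, ⟨f, hf, hi⟩, rfl⟩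
      exact ⟨f, ⟨hf, (hon (some f)).2 ⟨i, hi⟩⟩, hi.symm⟩
  have hcard : {i | ∃ f ∈ F₁, g i = some f}.ncard = 2 := by
    rw [← Set.ncard_image_of_injective _ hg, ← himage,
      Set.ncard_image_of_injective _ (Option.some_injective _), h2]
  -- Of the three sides two are faces in `F₁`; the remaining one is the outside or a face in `F₀`.
  have hcompl : {i | ∃ f ∈ F₁, g i = some f}ᶜ.ncard = 1 := by
    have := Set.ncard_add_ncard_compl {i | ∃ f ∈ F₁, g i = some f}
    rw [hcard, Nat.card_fin] at this
    omega
  obtain ⟨i, hi⟩ := Set.ncard_eq_one.1 hcompl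
  have hiff : ∀ j, (∀ f, g j = some f → f ∈ F₀) ↔ j = i := by
    intro j
    rw [← Set.mem_singleton_iff, ← hi]
    constructor
    · rintro h ⟨f, hf, hj⟩
      exact Set.disjoint_left.1 hdisj (h f hj) hf
    · intro h f hj
      have : f ∈ F₀ ∪ F₁ := hunion ▸ Set.mem_univ f
      exact this.resolve_right fun hf => h ⟨f, hf, hj⟩
  refine ⟨g i, ⟨(hon _).2 ⟨i, rfl⟩, (hiff i).2 rfl⟩, ?_⟩
  rintro h ⟨hv, hF⟩
  obtain ⟨j, rfl⟩ := (hon h).1 hv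
  rw [(hiff j).1 hF]

/-- A flat choice of sides leaves two faces at each vertex, provided that it takes the outside at the
vertices of the rim. -/
theorem Vertex.ncard_adjacent_ne (v : Vertex) (hc : IsCubicEven) {g₀ : Option Face}
    (hg₀ : v.On g₀) (hrim : v.pos ∈ rim → g₀ = none) :
    {f : Face | g₀ ≠ some f ∧ f.AdjacentTo v}.ncard = 2 := by
  obtain ⟨g, hg, hon⟩ := v.exists_label hc
  obtain ⟨i, rfl⟩ := (hon g₀).1 hg₀
  have himage : (some '' {f : Face | g i ≠ some f ∧ f.AdjacentTo v} : Set (Option Face)) =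
      g '' {i}ᶜ := by
    ext h
    constructor
    · rintro ⟨f, ⟨hf, hfv⟩, rfl⟩
      obtain ⟨j, hj⟩ := (hon (some f)).1 hfv
      refine ⟨j, ?_, hj⟩
      rintro rfl
      exact hf hj
    · rintro ⟨j, hj, rfl⟩
      have hvj : v.On (g j) := (hon _).2 ⟨j, rfl⟩
      cases hgj : g j with
      | none =>
        -- If the outside is a side at `v`, then `v` is on the rim and the outside is the omitted
        -- side; so the other two sides are faces.
        rw [hgj] at hvj
        exact absurd (hg (hgj.trans (hrim hvj).symm)) hj
      | some f =>
        rw [hgj] at hvj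
        exact ⟨f, ⟨fun h => hj (hg (hgj.trans h.symm)), hvj⟩, rfl⟩
  rw [← Set.ncard_image_of_injective _ (Option.some_injective _), himage,
    Set.ncard_image_of_injective _ hg]
  have := Set.ncard_add_ncard_compl ({i} : Set (Fin 3))
  rw [Set.ncard_singleton, Nat.card_fin] at this
  omega

end Partition

end Cylinder

theorem corollary2 [CWComplex (Set.univ : Set Cylinder)]
    (hG : Cylinder.IsCellularDecomposition)
    (G1 : Even (Nat.card Cylinder.Vertex))
    (G2 : ∀ v : Cylinder.Vertex, Cylinder.Vertex.degree v = 3)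
    (G3 : ∀ f : Cylinder.Face, Even (Cylinder.length (Cylinder.Face.boundary f)))
    (G4 : Odd (Cylinder.length (Cylinder.circleAt 0)) ∧
      Odd (Cylinder.length (Cylinder.circleAt 1))) :
    ∃ F₀ F₁ : Set Cylinder.Face,
      (Disjoint F₀ F₁ ∧ F₀ ∪ F₁ = Set.univ) ∧
      (∀ v : Cylinder.Vertex, {f ∈ F₁ | Cylinder.Face.AdjacentTo f v}.ncard = 2) ∧
      (∀ v : Cylinder.Vertex, Cylinder.Vertex.pos v ∉ Cylinder.rim →
        {f ∈ F₀ | Cylinder.Face.AdjacentTo f v}.ncard = 1) ∧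
      ∀ F₀' F₁' : Set Cylinder.Face, (Disjoint F₀' F₁' ∧ F₀' ∪ F₁' = Set.univ) →
        (∀ v : Cylinder.Vertex, {f ∈ F₁' | Cylinder.Face.AdjacentTo f v}.ncard = 2) →
        F₀' = F₀ ∧ F₁' = F₁ := by
  have hc : Cylinder.IsCubicEven := ⟨hG, G2, G3⟩
  obtain ⟨m, hm⟩ := hc.exists_isFlatOn_univ
  have hrim : ∀ m' : Cylinder.Vertex → Option Cylinder.Face, Cylinder.IsFlatOn Set.univ m' →
      ∀ v : Cylinder.Vertex, v.pos ∈ Cylinder.rim → m' v = none := by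
    rintro m' hm' v (h | h)
    · exact hm'.eq_none hc (Or.inl rfl) G4.1 h
    · exact hm'.eq_none hc (Or.inr rfl) G4.2 h
  have hmem : ∀ (f : Cylinder.Face) (v : Cylinder.Vertex), f.AdjacentTo v →
      ((∃ w, m w = some f) ↔ m v = some f) := fun f v hfv =>
    ⟨fun ⟨w, hw⟩ => hm.eq_some_of_mem hc hw hfv, fun h => ⟨v, h⟩⟩
  -- `F₀` consists of the faces that are values of `m`; by `hmem` membership can be tested at any
  -- vertex of the face.
  refine ⟨{f | ∃ w, m w = some f}, {f | ∃ w, m w = some f}ᶜ,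
    ⟨disjoint_compl_right, Set.union_compl_self _⟩, fun v => ?_, fun v hv => ?_, ?_⟩
  · rw [← v.ncard_adjacent_ne hc (hm.on v trivial) (hrim m hm v)]
    congr 1
    ext f
    exact and_congr_left fun hfv => not_congr (hmem f v hfv)
  · cases hmv : m v with
    | none =>
      have := hm.on v trivial
      rw [hmv] at this
      exact absurd this hv
    | some g =>
      have hgv : g.AdjacentTo v := by
        have := hm.on v trivial
        rwa [hmv] at this
      rw [Set.ncard_eq_one]
      refine ⟨g, ?_⟩
      ext f
      constructor
      · rintro ⟨hf, hfv⟩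
        exact (Option.some_injective _ (hmv.symm.trans ((hmem f v hfv).1 hf))).symm
      · rintro rfl
        exact ⟨⟨v, hmv⟩, hgv⟩
  · rintro F₀' F₁' ⟨hdisj, hunion⟩ h2
    have hex := fun v : Cylinder.Vertex => v.existsUnique_side hc hdisj hunion (h2 v)
    choose m' hm' hunique using hex
    have hflat : Cylinder.IsFlatOn Set.univ m' := by
      refine ⟨fun v _ => (hm' v).1, fun e _ u v hu hv g hg hug => ?_⟩
      -- Not being a face in `F₁'` is a property of the side alone. A side of `e` selected at `u` is
      -- therefore also the unique candidate at `v`.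
      exact (hunique v g ⟨hg.vertex hv, hug ▸ (hm' u).2⟩).symm
    obtain ⟨v₀, hv₀⟩ := (Cylinder.isCircuit_circleAt hG
      (Cylinder.circleAt_subset_rim (Or.inl rfl))).exists_vertex hG
    have heq : m' = m := hflat.eq_of_univ hc hm (u := v₀) (by
      rw [hrim m' hflat v₀ (Or.inl hv₀), hrim m hm v₀ (Or.inl hv₀)])
    have hF₀ : F₀' = {f | ∃ w, m w = some f} := by
      ext f
      obtain ⟨v, hv⟩ := (f.isCircuit_boundary hG).exists_vertex hG
      rw [Set.mem_ofPred_eq, hmem f v hv, ← heq]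
      constructor
      · intro hf
        refine (hunique v (some f) ⟨hv, ?_⟩).symm
        rintro _ ⟨⟩
        exact hf
      · exact (hm' v).2 f
    refine ⟨hF₀, ?_⟩
    rw [← hF₀]
    exact (IsCompl.compl_eq ⟨hdisj, codisjoint_iff.2 hunion⟩).symm
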